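/- **Setting.** Let $E$ be a measurable space and $\psi_1:E\to(0,+\infty)$ a measurable function. Let $L^\infty(\psi_1)$ be the space of measurable $f:E\to\mathbb R$ such that $|f|/\psi_1$ is bounded, with the norm $\|f\|_{\psi_1}=\sup_E|f|/\psi_1$. Let $(P_n)_{n\in\mathbb Z_+}$ be a positive semigroup of linear operators from $L^\infty(\psi_1)$ to itself ($P_0=\mathrm{Id}$, $P_{m+n}=P_mP_n$), each $P_n$ being given by a positive kernel, i.e. $P_nf(x)=\int_E f(y)\,P_n(x,dy)$. For a positive measure $\mu$ on $E$ with $\mu(\psi_1)<+\infty$ and $f\in L^\infty(\psi_1)$, write $\mu(f)=\int_E f\,d\mu$ and $\mu P_nf=\int_E P_nf(x)\,\mu(dx)$. **Condition (G).** There exist positive real constants $\theta_1,\theta_2,c_1,c_2,c_3$, an integer $n_1\ge1$, a measurable function $\psi_2:E\to[0,+\infty)$, a measurable set $K\subset E$ and a probability measure $\nu$ on $K$ such that: - (G1) for all $x\in K$ and all measurable $A\subset K$, $P_{n_1}(\psi_1\mathbf 1_A)(x)\ge c_1\nu(A)\psi_1(x)$; - (G2) $\theta_1<\theta_2$, $\inf_{K}\psi_2/\psi_1>0$,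 $\sup_{E}\psi_2/\psi_1\le1$, and for all $x\in E$, $P_1\psi_1(x)\le\theta_1\psi_1(x)+c_2\mathbf 1_K(x)\psi_1(x)$ and $P_1\psi_2(x)\ge\theta_2\psi_2(x)$; - (G3) $\displaystyle\sup_{n\in\mathbb Z_+}\frac{\sup_{y\in K}P_n\psi_1(y)/\psi_1(y)}{\inf_{y\in K}P_n\psi_1(y)/\psi_1(y)}\le c_3$; - (G4) for all $x\in K$ there exists $n_4(x)$ such that $P_n(\mathbf 1_K\psi_1)(x)>0$ for all $n\ge n_4(x)$. **Theorem 2.1.** Assume Condition (G). Then there exist a positive measure $\nu_P$ on $E$ with $\nu_P(\psi_1)=1$ and $\nu_P(\psi_2)>0$, and constants $C<+\infty$ and $\alpha\in(0,1)$ such that, for all measurable $f:E\to\mathbb R$ with $|f|\le\psi_1$ and all positive measures $\mu$ on $E$ with $\mu(\psi_1)<+\infty$ and $\mu(\psi_2)>0$, $$\left|\frac{\mu P_nf}{\mu P_n\psi_1}-\nu_P(f)\right|\le C\alpha^n\frac{\mu(\psi_1)}{\mu(\psi_2)},\qquad\forall n\in\mathbb Z_+.$$ In addition, there exist $\theta_0>0$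 such that $\nu_PP_n=\theta_0^n\nu_P$ for all $n\in\mathbb Z_+$ (that is, $\nu_PP_nf=\theta_0^n\nu_P(f)$ for all $f\in L^\infty(\psi_1)$), and a function $\eta:E\to[0,+\infty)$ in $L^\infty(\psi_1)$ such that $\theta_0^{-n}P_n\psi_1$ converges geometrically to $\eta$ in $L^\infty(\psi_1)$ (that is, $\|\theta_0^{-n}P_n\psi_1-\eta\|_{\psi_1}\le D\gamma^n$ for all $n\in\mathbb Z_+$, for some constants $D<+\infty$ and $\gamma\in(0,1)$), $P_1\eta=\theta_0\eta$ and $\nu_P(\eta)=1$. Moreover, there exist constants $C'>0$ and $\beta\in(0,1)$ such that, for all measurable $f:E\to\mathbb R$ with $|f|\le\psi_1$ and all positive measures $\mu$ on $E$ with $\mu(\psi_1)<+\infty$, $$\left|\theta_0^{-n}\mu P_nf-\mu(\eta)\nu_P(f)\right|\le C'\beta^n\mu(\psi_1),\qquad\forall n\in\mathbb Z_+.$$ -/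

import Mathlib

open MeasureTheory ProbabilityTheory

namespace WeightedSemigroup

/-- The space `L^∞(ψ)` of measurable functions `f : E → ℝ` such that `|f| / ψ` is bounded. -/
def LInfty {E : Type*} [MeasurableSpace E] (ψ : E → ℝ) : Submodule ℝ (E → ℝ) where
  carrier := {f | Measurable f ∧ ∃ C : ℝ, ∀ x, |f x| ≤ C * ψ x}
  zero_mem' := ⟨measurable_const, 0, fun x => by simp⟩
  add_mem' := by
    rintro f g ⟨hf, C, hC⟩ ⟨hg, D, hD⟩
    refine ⟨hf.add hg, C + D, fun x => ?_⟩
    calc |(f + g) x| ≤ |f x| + |g x| := abs_add_le _ _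
      _ ≤ (C + D) * ψ x := by linarith [hC x, hD x]
  smul_mem' := by
    rintro a f ⟨hf, C, hC⟩
    refine ⟨hf.const_smul a, |a| * C, fun x => ?_⟩
    calc |(a • f) x| = |a| * |f x| := by simp [abs_mul]
      _ ≤ |a| * (C * ψ x) := mul_le_mul_of_nonneg_left (hC x) (abs_nonneg a)
      _ = |a| * C * ψ x := by ring

/-- The norm `‖f‖_ψ = sup_x |f x| / ψ x` of `L^∞(ψ)`. -/
noncomputable def wnorm {E : Type*} [MeasurableSpace E] {ψ : E → ℝ} (f : LInfty ψ) : ℝ :=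
  ⨆ x, |f.1 x| / ψ x

/-- The function `ψ 𝟙_A`, for a measurable set `A`, as an element of `L^∞(ψ)`. -/
noncomputable def weightOn {E : Type*} [MeasurableSpace E] {ψ : E → ℝ} (hψ : Measurable ψ)
    (hpos : ∀ x, 0 < ψ x) (A : Set E) (hA : MeasurableSet A) : LInfty ψ :=
  ⟨A.indicator ψ, hψ.indicator hA, 1, fun x => by
    by_cases hx : x ∈ A
    · simp [hx, abs_of_pos (hpos x)]
    · simp [hx, (hpos x).le]⟩

/-- The function `ψ` as an element of `L^∞(ψ)`. -/
def weight {E : Type*} [MeasurableSpace E] {ψ : E → ℝ} (hψ : Measurable ψ)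
    (hpos : ∀ x, 0 < ψ x) : LInfty ψ :=
  ⟨ψ, hψ, 1, fun x => by simp [abs_of_pos (hpos x)]⟩

/-- `(P_n)` is a positive semigroup of operators from `L^∞(ψ)` to itself, each `P_n` being an
integral operator given by a positive kernel (so that `P_n` acts on measures on the left).
Positivity is implied by the last field. -/
structure IsPositiveSemigroup {E : Type*} [MeasurableSpace E] {ψ : E → ℝ}
    (P : ℕ → LInfty ψ →ₗ[ℝ] LInfty ψ) : Prop where
  zero : P 0 = LinearMap.id
  add : ∀ m n, P (m + n) = P m ∘ₗ P n
  kernel : ∀ n, ∃ κ : Kernel E E, ∀ (f : LInfty ψ) (x : E),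
    Integrable f.1 (κ x) ∧ (P n f).1 x = ∫ y, f.1 y ∂(κ x)

/-- Condition (G) for the semigroup `P` on `L^∞(ψ₁)` and the function `ψ₂`.
(Measurability of `ψ₂` is part of `ψ₂ ∈ L^∞(ψ₁)`; its boundedness follows from `ψ₂ ≤ ψ₁`.) -/
def ConditionG {E : Type*} [MeasurableSpace E] {ψ₁ : E → ℝ} (hψ : Measurable ψ₁)
    (hpos : ∀ x, 0 < ψ₁ x) (P : ℕ → LInfty ψ₁ →ₗ[ℝ] LInfty ψ₁) (ψ₂ : LInfty ψ₁) : Prop :=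
  ∃ (θ₁ θ₂ c₁ c₂ c₃ : ℝ) (n₁ : ℕ) (K : Set E) (hK : MeasurableSet K) (ν : Measure E),
    0 < θ₁ ∧ 0 < θ₂ ∧ 0 < c₁ ∧ 0 < c₂ ∧ 0 < c₃ ∧ 1 ≤ n₁ ∧
    (∀ x, 0 ≤ ψ₂.1 x) ∧
    -- `ν` is a probability measure on `K`
    IsProbabilityMeasure ν ∧ ν Kᶜ = 0 ∧
    -- (G1) local Dobrushin coefficient
    (∀ x ∈ K, ∀ (A : Set E) (hA : MeasurableSet A), A ⊆ K →
      c₁ * ν.real A * ψ₁ x ≤ (P n₁ (weightOn hψ hpos A hA)).1 x) ∧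
    -- (G2) global Lyapunov criterion
    θ₁ < θ₂ ∧
    (∃ δ : ℝ, 0 < δ ∧ ∀ x ∈ K, δ ≤ ψ₂.1 x / ψ₁ x) ∧
    (∀ x, ψ₂.1 x / ψ₁ x ≤ 1) ∧
    (∀ x, (P 1 (weight hψ hpos)).1 x ≤ θ₁ * ψ₁ x + c₂ * K.indicator ψ₁ x) ∧
    (∀ x, θ₂ * ψ₂.1 x ≤ (P 1 ψ₂).1 x) ∧
    -- (G3) local Harnack inequality (by (G2), `P_n ψ₁ > 0` on `K`)
    (∀ n : ℕ, ∀ x ∈ K, ∀ y ∈ K,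
      (P n (weight hψ hpos)).1 x / ψ₁ x ≤ c₃ * ((P n (weight hψ hpos)).1 y / ψ₁ y)) ∧
    -- (G4) aperiodicity
    (∀ x ∈ K, ∃ n₄ : ℕ, ∀ n ≥ n₄, 0 < (P n (weightOn hψ hpos K hK)).1 x)

end WeightedSemigroup

/-!
The operators `P n` have, up to a geometrically small error, rank one; everything else is read off
from this.

Fix `y₀ ∈ K` and put `r n = P n ψ₂ (y₀) / ψ₁ (y₀)`. By (G2) `P n ψ₁` is at most
`θ₁ ^ n ψ₁ + A P n ψ₂`, and with (G3) this makes `r n` comparable to `P n ψ₁ / ψ₁` on `K` and, up to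
a constant, an upper bound for it on all of `E`, while `r (n + 1) ≥ θ₂ r n`. By (G1) and (G4) there
is a minorization on `K` at all large times. These facts are bundled in `HarrisData`, which
`ConditionG.exists_harrisData` derives from Condition (G).

The Markov kernels `f ↦ P m (f * P j ψ₁) / P (j + m) ψ₁` have the Lyapunov functions
`r j ψ₁ / P j ψ₁`: `HarrisData.lyapunov` is the drift inequality, whose additive constant does not
depend on `m`, and `HarrisData.small_set` says that the sublevel sets are small, uniformly in the
horizon `j`. The argument of Hairer and Mattingly then gives a contraction in a weighted norm,
`HarrisData.contraction`, and by iteration `HarrisData.rank_one`: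
`P n f = c n f • P n ψ₁ + O(α ^ n r n ψ₁)` with `c n f = P n f (y₀) / P n ψ₁ (y₀)`.

Applied to `P j f`, this shows that the functionals `c n` are Cauchy in the dual of `L^∞(ψ₁)`; since
they are given by measures, so is their limit `νP` (`exists_tendsto_integral_weighted`). The limit
is an eigenmeasure, with an eigenvalue `θ₀` such that `θ₀ ^ n` is comparable to `r n`, and
`θ₀ ^ (-n) P n ψ₁` is Cauchy, with the eigenfunction `η` as limit (`HarrisData.exists_eigen`).

The ratio estimate needs a lower bound for `μ(η)` in terms of `μ(ψ₂)`. Iterating (G2) gives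
`ψ₂ ≤ (θ₁ / θ₂) ^ m ψ₁ + B (θ₀ / θ₂) ^ m η` for all `m`, which only bounds `μ(η) / μ(ψ₁)` below by a
power of `μ(ψ₂) / μ(ψ₁)`; `exists_geometric_bound` chooses `m` proportional to `n` and gives up part
of the rate to obtain the linear dependence.
-/

namespace WeightedSemigroup

variable {E : Type*} [MeasurableSpace E] {ψ : E → ℝ}

/-! ### Positive operators on `L^∞(ψ)` -/

/-- A linear operator on `L^∞(ψ)` is positive if it maps nonnegative functions to nonnegative
functions. -/
def IsPositiveOp (T : LInfty ψ →ₗ[ℝ] LInfty ψ) : Prop :=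
  ∀ f : LInfty ψ, (∀ x, 0 ≤ f.1 x) → ∀ x, 0 ≤ (T f).1 x

namespace IsPositiveOp

variable {T : LInfty ψ →ₗ[ℝ] LInfty ψ}

theorem mono (hT : IsPositiveOp T) {f g : LInfty ψ} (h : ∀ x, f.1 x ≤ g.1 x) (x : E) :
    (T f).1 x ≤ (T g).1 x := by
  have := hT (g - f) (fun x => sub_nonneg.2 (h x)) x
  rw [map_sub] at this
  exact sub_nonneg.1 this

theorem le_smul (hT : IsPositiveOp T) {f g : LInfty ψ} {a : ℝ} (h : ∀ x, f.1 x ≤ a * g.1 x)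
    (x : E) : (T f).1 x ≤ a * (T g).1 x := by
  have := hT.mono (f := f) (g := a • g) h x
  rwa [map_smul] at this

theorem smul_le (hT : IsPositiveOp T) {f g : LInfty ψ} {a : ℝ} (h : ∀ x, a * g.1 x ≤ f.1 x)
    (x : E) : a * (T g).1 x ≤ (T f).1 x := by
  have := hT.mono (f := a • g) (g := f) h x
  rwa [map_smul] at this

theorem le_add_smul (hT : IsPositiveOp T) {f g g' : LInfty ψ} {a b : ℝ}
    (h : ∀ x, f.1 x ≤ a * g.1 x + b * g'.1 x) (x : E) :
    (T f).1 x ≤ a * (T g).1 x + b * (T g').1 x := by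
  have := hT.mono (f := f) (g := a • g + b • g') h x
  rwa [map_add, map_smul, map_smul] at this

theorem abs_le_smul (hT : IsPositiveOp T) {f g : LInfty ψ} {a : ℝ}
    (h : ∀ x, |f.1 x| ≤ a * g.1 x) (x : E) : |(T f).1 x| ≤ a * (T g).1 x := by
  rw [abs_le]
  refine ⟨?_, hT.le_smul (fun y => (le_abs_self _).trans (h y)) x⟩
  have := hT.le_smul (f := -f) (fun y => (neg_le_abs (f.1 y)).trans (h y)) x
  rw [map_neg] at this
  have h2 : -(T f).1 x ≤ a * (T g).1 x := this
  linarith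

end IsPositiveOp

/-- The part of Condition (G) that drives the contraction argument, for a positive semigroup `P`.
Here `w` is the weight `ψ` itself and `k` is `ψ 𝟙_K`, the functional `ℓ` stands for
`F ↦ ∫ F / ψ ∂ν`, and `r n` is a normalising sequence that is comparable with `P n ψ / ψ`
uniformly on `K`, dominates it on all of `E` (both up to the factor `C`), and grows at least like
`θ₂ ^ n`. The point `y₀` of `K` serves to normalise. -/
structure HarrisData (P : ℕ → LInfty ψ →ₗ[ℝ] LInfty ψ) (w k : LInfty ψ) (K : Set E)
    (ℓ : LInfty ψ →ₗ[ℝ] ℝ) (y₀ : E) (r : ℕ → ℝ) (θ₁ θ₂ c₂ C : ℝ) : Prop where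
  weight_pos : ∀ x, 0 < ψ x
  zero : ∀ f, P 0 f = f
  add : ∀ m n f, P (m + n) f = P m (P n f)
  pos : ∀ n, IsPositiveOp (P n)
  w_eq : ∀ x, w.1 x = ψ x
  k_on : ∀ x ∈ K, k.1 x = ψ x
  k_off : ∀ x ∉ K, k.1 x = 0
  θ₁_pos : 0 < θ₁
  θ_lt : θ₁ < θ₂
  c₂_pos : 0 < c₂
  one_le : 1 ≤ C
  drift : ∀ x, (P 1 w).1 x ≤ θ₁ * w.1 x + c₂ * k.1 x
  r_pos : ∀ n, 0 < r n
  r_grow : ∀ n, θ₂ * r n ≤ r (n + 1)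
  upper : ∀ n x, (P n w).1 x ≤ C * r n * ψ x
  lower : ∀ n, ∀ x ∈ K, r n * ψ x ≤ C * (P n w).1 x
  mem : y₀ ∈ K
  ℓ_mono : ∀ f g : LInfty ψ, (∀ x, f.1 x ≤ g.1 x) → ℓ f ≤ ℓ g
  ℓ_lower : ∀ (f : LInfty ψ) (a : ℝ), (∀ x ∈ K, a * ψ x ≤ f.1 x) → a ≤ ℓ f
  minor : ∃ N : ℕ, ∀ n ≥ N, ∃ d : ℝ, 0 < d ∧ ∀ f : LInfty ψ, (∀ x, 0 ≤ f.1 x) →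
    ∀ x ∈ K, d * ψ x * ℓ f ≤ (P n f).1 x

namespace HarrisData

variable {P : ℕ → LInfty ψ →ₗ[ℝ] LInfty ψ} {w k : LInfty ψ} {K : Set E}
    {ℓ : LInfty ψ →ₗ[ℝ] ℝ} {y₀ : E} {r : ℕ → ℝ} {θ₁ θ₂ c₂ C : ℝ}

theorem C_pos (H : HarrisData P w k K ℓ y₀ r θ₁ θ₂ c₂ C) : 0 < C := one_pos.trans_le H.one_le

theorem θ₂_pos (H : HarrisData P w k K ℓ y₀ r θ₁ θ₂ c₂ C) : 0 < θ₂ := H.θ₁_pos.trans H.θ_lt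

theorem w_nonneg (H : HarrisData P w k K ℓ y₀ r θ₁ θ₂ c₂ C) (x : E) : 0 ≤ w.1 x := by
  rw [H.w_eq]; exact (H.weight_pos x).le

theorem k_nonneg (H : HarrisData P w k K ℓ y₀ r θ₁ θ₂ c₂ C) (x : E) : 0 ≤ k.1 x := by
  by_cases hx : x ∈ K
  · rw [H.k_on x hx]; exact (H.weight_pos x).le
  · rw [H.k_off x hx]

theorem u_nonneg (H : HarrisData P w k K ℓ y₀ r θ₁ θ₂ c₂ C) (n : ℕ) (x : E) :
    0 ≤ (P n w).1 x := H.pos n w H.w_nonneg x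

theorem u_pos (H : HarrisData P w k K ℓ y₀ r θ₁ θ₂ c₂ C) (n : ℕ) : 0 < (P n w).1 y₀ := by
  have h1 := H.lower n y₀ H.mem
  have h2 := mul_pos (H.r_pos n) (H.weight_pos y₀)
  exact pos_of_mul_pos_right (h2.trans_le h1) H.C_pos.le

theorem k_le_of_on (H : HarrisData P w k K ℓ y₀ r θ₁ θ₂ c₂ C) {f : LInfty ψ} {a : ℝ}
    (hf : ∀ x, 0 ≤ f.1 x) (h : ∀ x ∈ K, a * ψ x ≤ f.1 x) (x : E) : a * k.1 x ≤ f.1 x := by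
  by_cases hx : x ∈ K
  · rw [H.k_on x hx]; exact h x hx
  · rw [H.k_off x hx]; simpa using hf x

theorem r_grow_iter (H : HarrisData P w k K ℓ y₀ r θ₁ θ₂ c₂ C) (n m : ℕ) :
    θ₂ ^ m * r n ≤ r (n + m) := by
  induction m with
  | zero => simp
  | succ m ih =>
    calc θ₂ ^ (m + 1) * r n = θ₂ * (θ₂ ^ m * r n) := by ring
      _ ≤ θ₂ * r (n + m) := mul_le_mul_of_nonneg_left ih H.θ₂_pos.le
      _ ≤ r (n + (m + 1)) := H.r_grow (n + m)

theorem drift_step (H : HarrisData P w k K ℓ y₀ r θ₁ θ₂ c₂ C) (m : ℕ) (x : E) :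
    (P (m + 1) w).1 x ≤ θ₁ * (P m w).1 x + c₂ * (P m k).1 x := by
  rw [H.add]
  exact (H.pos m).le_add_smul H.drift x

/-- Last-exit decomposition: what is left of `P M ψ` outside of `θ₁ ^ M ψ` has gone through `K`. -/
theorem last_exit (H : HarrisData P w k K ℓ y₀ r θ₁ θ₂ c₂ C) (M : ℕ) (x : E) :
    (P M w).1 x ≤ θ₁ ^ M * ψ x + c₂ * (max 1 θ₁) ^ M * ∑ i ∈ Finset.range M, (P i k).1 x := by
  induction M with
  | zero => simp [H.zero, H.w_eq]
  | succ M ih =>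
    have h1 := H.drift_step M x
    have hk : 0 ≤ (P M k).1 x := H.pos M k H.k_nonneg x
    have hs : 0 ≤ ∑ i ∈ Finset.range M, (P i k).1 x :=
      Finset.sum_nonneg fun i _ => H.pos i k H.k_nonneg x
    have hm1 : 1 ≤ (max 1 θ₁) ^ (M + 1) := one_le_pow₀ (le_max_left _ _)
    have hm2 : θ₁ * (max 1 θ₁) ^ M ≤ (max 1 θ₁) ^ (M + 1) := by
      rw [pow_succ']
      exact mul_le_mul_of_nonneg_right (le_max_right _ _) (by positivity)
    rw [Finset.sum_range_succ]
    have e1 := mul_le_mul_of_nonneg_left ih H.θ₁_pos.le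
    have e2 := mul_le_mul_of_nonneg_right hm2 (mul_nonneg H.c₂_pos.le hs)
    have e3 := mul_le_mul_of_nonneg_right hm1 (mul_nonneg H.c₂_pos.le hk)
    calc _ ≤ θ₁ * (P M w).1 x + c₂ * (P M k).1 x := h1
      _ ≤ θ₁ ^ (M + 1) * ψ x + ((θ₁ * (max 1 θ₁) ^ M) *
            (c₂ * ∑ i ∈ Finset.range M, (P i k).1 x)) + 1 * (c₂ * (P M k).1 x) := by
          rw [pow_succ]; linarith
      _ ≤ θ₁ ^ (M + 1) * ψ x + ((max 1 θ₁) ^ (M + 1) *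
            (c₂ * ∑ i ∈ Finset.range M, (P i k).1 x)) +
            (max 1 θ₁) ^ (M + 1) * (c₂ * (P M k).1 x) := by linarith
      _ = _ := by ring

/-- Lyapunov inequality for the weight relative to the functions `P n ψ`, with a contraction factor
that is small for large `m` and a constant that does not depend on `m`. -/
theorem lyapunov (H : HarrisData P w k K ℓ y₀ r θ₁ θ₂ c₂ C) (m j : ℕ) (x : E) :
    r j * (P m w).1 x ≤ (θ₁ / θ₂) ^ m * r (j + m) * ψ x
      + c₂ * C / (θ₂ - θ₁) * (P (j + m) w).1 x := by
  have hθ := sub_pos.2 H.θ_lt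
  have hθ2 := H.θ₂_pos
  induction m generalizing j with
  | zero =>
    have : 0 ≤ c₂ * C / (θ₂ - θ₁) * (P j w).1 x :=
      mul_nonneg (div_nonneg (mul_nonneg H.c₂_pos.le H.C_pos.le) hθ.le) (H.u_nonneg _ _)
    simpa [H.zero, H.w_eq] using this
  | succ m ih =>
    set B := c₂ * C / (θ₂ - θ₁) with hB
    have hBe : θ₁ * B + c₂ * C = θ₂ * B := by rw [hB]; field_simp; ring
    have h1 := H.drift_step m x
    -- on `K` the function `ψ` is dominated by `P (j + 1) ψ`, and `P m` turns it into
    -- `P (j + m + 1) ψ`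
    have h2 : r (j + 1) * (P m k).1 x ≤ C * (P (j + (m + 1)) w).1 x := by
      have e : P (j + (m + 1)) w = P m (P (j + 1) w) := by rw [← H.add]; congr 2; ring
      rw [e]
      have := (H.pos m).mono (f := r (j + 1) • k) (g := C • P (j + 1) w)
        (H.k_le_of_on (fun y => mul_nonneg H.C_pos.le (H.u_nonneg _ y)) (H.lower (j + 1))) x
      rwa [map_smul, map_smul] at this
    have h3 := ih (j + 1)
    rw [show j + 1 + m = j + (m + 1) by ring] at h3
    have hu : 0 ≤ θ₁ * (P m w).1 x + c₂ * (P m k).1 x :=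
      add_nonneg (mul_nonneg H.θ₁_pos.le (H.u_nonneg _ _))
        (mul_nonneg H.c₂_pos.le (H.pos m k H.k_nonneg x))
    refine le_of_mul_le_mul_left ?_ hθ2
    calc θ₂ * (r j * (P (m + 1) w).1 x)
        ≤ θ₂ * r j * (θ₁ * (P m w).1 x + c₂ * (P m k).1 x) := by
          rw [mul_assoc]
          exact mul_le_mul_of_nonneg_left (mul_le_mul_of_nonneg_left h1 (H.r_pos j).le) hθ2.le
      _ ≤ r (j + 1) * (θ₁ * (P m w).1 x + c₂ * (P m k).1 x) :=
          mul_le_mul_of_nonneg_right (H.r_grow j) hu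
      _ = θ₁ * (r (j + 1) * (P m w).1 x) + c₂ * (r (j + 1) * (P m k).1 x) := by ring
      _ ≤ θ₁ * ((θ₁ / θ₂) ^ m * r (j + (m + 1)) * ψ x + B * (P (j + (m + 1)) w).1 x)
            + c₂ * (C * (P (j + (m + 1)) w).1 x) :=
          add_le_add (mul_le_mul_of_nonneg_left h3 H.θ₁_pos.le)
            (mul_le_mul_of_nonneg_left h2 H.c₂_pos.le)
      _ = θ₁ * ((θ₁ / θ₂) ^ m * r (j + (m + 1)) * ψ x)
            + (θ₁ * B + c₂ * C) * (P (j + (m + 1)) w).1 x := by ring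
      _ = _ := by rw [hBe, pow_succ]; field_simp

theorem r_add_le (H : HarrisData P w k K ℓ y₀ r θ₁ θ₂ c₂ C) (m n : ℕ) :
    r (m + n) ≤ C ^ 3 * r m * r n := by
  have h1 := H.lower (m + n) y₀ H.mem
  have hC := H.C_pos
  have h2 : (P (m + n) w).1 y₀ ≤ (C * r n) * (P m w).1 y₀ := by
    rw [H.add]
    exact (H.pos m).le_smul (fun y => by rw [H.w_eq]; exact H.upper n y) y₀
  have h3 := H.upper m y₀
  refine le_of_mul_le_mul_right ?_ (H.weight_pos y₀)
  calc r (m + n) * ψ y₀ ≤ C * (P (m + n) w).1 y₀ := h1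
    _ ≤ C * (C * r n * (P m w).1 y₀) := mul_le_mul_of_nonneg_left h2 hC.le
    _ ≤ C * (C * r n * (C * r m * ψ y₀)) := by
        have := H.r_pos n; gcongr
    _ = _ := by ring

theorem r_mul_le (H : HarrisData P w k K ℓ y₀ r θ₁ θ₂ c₂ C) (m n : ℕ) :
    r m * r n ≤ (C * (1 + c₂ * C / (θ₂ - θ₁) * C)) * r (m + n) := by
  have hθ := sub_pos.2 H.θ_lt
  have hC := H.C_pos
  have hc := H.c₂_pos
  have hr := H.r_pos
  have hl := H.lyapunov n m y₀
  have h1 := H.lower n y₀ H.mem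
  have h2 := H.upper (m + n) y₀
  have h3 : (θ₁ / θ₂) ^ n ≤ 1 :=
    pow_le_one₀ (div_nonneg H.θ₁_pos.le H.θ₂_pos.le) ((div_le_one H.θ₂_pos).2 H.θ_lt.le)
  set B := c₂ * C / (θ₂ - θ₁) with hB
  have hB0 : 0 ≤ B := by positivity
  have hψ := H.weight_pos y₀
  refine le_of_mul_le_mul_right ?_ hψ
  calc r m * r n * ψ y₀ = r m * (r n * ψ y₀) := by ring
    _ ≤ r m * (C * (P n w).1 y₀) := mul_le_mul_of_nonneg_left h1 (hr m).le
    _ = C * (r m * (P n w).1 y₀) := by ring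
    _ ≤ C * ((θ₁ / θ₂) ^ n * r (m + n) * ψ y₀ + B * (P (m + n) w).1 y₀) :=
        mul_le_mul_of_nonneg_left hl hC.le
    _ ≤ C * (1 * r (m + n) * ψ y₀ + B * (C * r (m + n) * ψ y₀)) := by
        have := hr (m + n); gcongr
    _ = _ := by ring

/-- The points where `P (j + m) ψ` is not too small compared with `r (j + m) ψ` form a small set
for `P m`, uniformly in the horizon `j`. -/
theorem small_set (H : HarrisData P w k K ℓ y₀ r θ₁ θ₂ c₂ C) {R : ℝ} (hR : 0 < R) :
    ∃ m₀ : ℕ, ∀ m ≥ m₀, ∃ κ : ℝ, 0 < κ ∧ ∀ j x, r (j + m) * ψ x ≤ R * (P (j + m) w).1 x →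
      ∀ f : LInfty ψ, (∀ y, 0 ≤ f.1 y) →
        κ * (P (j + m) w).1 x * ℓ f ≤ r j * (P m f).1 x := by
  obtain ⟨N, hN⟩ := H.minor
  have hC := H.C_pos
  have hr := H.r_pos
  have hc := H.c₂_pos
  have hθ2 := H.θ₂_pos
  have hq0 : 0 < θ₁ / θ₂ := div_pos H.θ₁_pos hθ2
  have hq1 : θ₁ / θ₂ < 1 := (div_lt_one hθ2).2 H.θ_lt
  obtain ⟨M, hM⟩ := exists_pow_lt_of_lt_one (show 0 < 1 / (2 * C * R) by positivity) hq1
  refine ⟨M + N, fun m hm => ?_⟩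
  obtain ⟨s, rfl⟩ : ∃ s, m = M + s := ⟨m - M, by omega⟩
  have hs : N ≤ s := by omega
  choose! d hd0 hd using hN
  -- a common minorization constant for the times `M + s - i`, `i < M`
  obtain ⟨δ, hδ0, hδ⟩ : ∃ δ : ℝ, 0 < δ ∧ ∀ i ∈ Finset.range M, δ ≤ d (M + s - i) := by
    by_cases hM0 : (Finset.range M).Nonempty
    · obtain ⟨i, hi, hmin⟩ := Finset.exists_min_image (Finset.range M) (fun i => d (M + s - i)) hM0
      refine ⟨d (M + s - i), hd0 _ ?_, hmin⟩
      have := Finset.mem_range.1 hi; omega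
    · exact ⟨1, one_pos, fun i hi => absurd ⟨i, hi⟩ hM0⟩
  set D := c₂ * (max 1 θ₁) ^ M with hD
  have hD0 : 0 < D := by positivity
  have hrs := hr s
  refine ⟨δ / (2 * C * D * (C ^ 3 * r s) * (M + 1)), by positivity, fun j x hx f hf => ?_⟩
  set S := ∑ i ∈ Finset.range M, (P i k).1 x with hS
  have hS0 : 0 ≤ S := Finset.sum_nonneg fun i _ => H.pos i k H.k_nonneg x
  have hl := H.last_exit M x
  have hψ := H.weight_pos x
  have hℓ0 : 0 ≤ ℓ f := by
    have := H.ℓ_mono 0 f hf; simpa using this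
  set u := (P (j + (M + s)) w).1 x with hu
  have h1 : u ≤ C * r (j + s) * (P M w).1 x := by
    rw [hu, show j + (M + s) = M + (j + s) by ring, H.add]
    exact (H.pos M).le_smul (fun y => by rw [H.w_eq]; exact H.upper _ y) x
  have h2 : C * r (j + s) * (θ₁ ^ M * ψ x) ≤ u / 2 := by
    have e1 : θ₁ ^ M * r (j + s) ≤ (θ₁ / θ₂) ^ M * r (j + (M + s)) := by
      have := H.r_grow_iter (j + s) M
      rw [show j + s + M = j + (M + s) by ring] at this
      calc θ₁ ^ M * r (j + s) = (θ₁ / θ₂) ^ M * (θ₂ ^ M * r (j + s)) := by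
            rw [div_pow]; field_simp
        _ ≤ _ := mul_le_mul_of_nonneg_left this (by positivity)
    calc C * r (j + s) * (θ₁ ^ M * ψ x) = C * ψ x * (θ₁ ^ M * r (j + s)) := by ring
      _ ≤ C * ψ x * ((θ₁ / θ₂) ^ M * r (j + (M + s))) := by gcongr
      _ ≤ C * ψ x * (1 / (2 * C * R) * r (j + (M + s))) := by
          have := hr (j + (M + s)); gcongr
      _ = (1 / (2 * R)) * (r (j + (M + s)) * ψ x) := by field_simp
      _ ≤ (1 / (2 * R)) * (R * u) := by gcongr
      _ = u / 2 := by field_simp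
  have h3 : u ≤ 2 * C * D * r (j + s) * S := by
    have : u ≤ C * r (j + s) * (θ₁ ^ M * ψ x + D * S) :=
      h1.trans (mul_le_mul_of_nonneg_left hl (mul_nonneg hC.le (hr _).le))
    nlinarith
  have h4 : r (j + s) ≤ C ^ 3 * r s * r j := by
    have := H.r_add_le j s; linarith
  have h5 : δ * ℓ f * S ≤ (M + 1) * (P (M + s) f).1 x := by
    have hPf := H.pos (M + s) f hf x
    have : ∀ i ∈ Finset.range M, δ * ℓ f * (P i k).1 x ≤ (P (M + s) f).1 x := fun i hi => by
      have hi' := Finset.mem_range.1 hi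
      rw [show M + s = i + (M + s - i) by omega, H.add]
      refine (H.pos i).smul_le (H.k_le_of_on (fun y => H.pos _ f hf y) fun y hy => ?_) x
      refine le_trans ?_ (hd _ (by omega) f hf y hy)
      have := hδ i hi
      have hy := H.weight_pos y
      calc δ * ℓ f * ψ y = δ * (ψ y * ℓ f) := by ring
        _ ≤ d (M + s - i) * (ψ y * ℓ f) := by gcongr
        _ = _ := by ring
    have h := Finset.sum_le_sum this
    rw [← Finset.mul_sum] at h
    simp only [Finset.sum_const, Finset.card_range, nsmul_eq_mul] at h
    linarith
  have h6 : u ≤ 2 * C * D * (C ^ 3 * r s * r j) * S :=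
    h3.trans (by gcongr)
  have hrj := hr j
  calc δ / (2 * C * D * (C ^ 3 * r s) * (M + 1)) * u * ℓ f
      ≤ δ / (2 * C * D * (C ^ 3 * r s) * (M + 1)) * (2 * C * D * (C ^ 3 * r s * r j) * S) * ℓ f := by
        gcongr
    _ = r j / (M + 1) * (δ * ℓ f * S) := by field_simp
    _ ≤ r j / (M + 1) * ((M + 1) * (P (M + s) f).1 x) := by gcongr
    _ = _ := by field_simp

end HarrisData

/-! ### Contraction in a weighted norm -/

/-- Geometric decay along multiples of `m` is geometric decay. -/
theorem exists_pow_div_le_geometric {a : ℝ} (ha0 : 0 < a) (ha1 : a < 1) {m : ℕ} (hm : 0 < m) :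
    ∃ α : ℝ, 0 < α ∧ α < 1 ∧ ∀ n : ℕ, a ^ (n / m) ≤ α ^ n / α ^ m := by
  obtain ⟨α, hα0, hα1, hαm⟩ : ∃ α : ℝ, 0 < α ∧ α < 1 ∧ a ≤ α ^ m := by
    refine ⟨a ^ ((m : ℝ)⁻¹), Real.rpow_pos_of_pos ha0 _,
      Real.rpow_lt_one ha0.le ha1 (by positivity), ?_⟩
    rw [Real.rpow_inv_natCast_pow ha0.le hm.ne']
  refine ⟨α, hα0, hα1, fun n => ?_⟩
  rw [le_div_iff₀ (by positivity)]
  calc a ^ (n / m) * α ^ m ≤ (α ^ m) ^ (n / m) * α ^ m := by gcongr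
    _ = α ^ (m * (n / m) + m) := by rw [← pow_mul, pow_add]
    _ ≤ α ^ n := pow_le_pow_of_le_one hα0.le hα1.le (by
        have := Nat.div_add_mod n m; have := Nat.mod_lt n hm; omega)

namespace HarrisData

variable {P : ℕ → LInfty ψ →ₗ[ℝ] LInfty ψ} {w k : LInfty ψ} {K : Set E}
    {ℓ : LInfty ψ →ₗ[ℝ] ℝ} {y₀ : E} {r : ℕ → ℝ} {θ₁ θ₂ c₂ C : ℝ}

/-- One-step contraction modulo multiples of `P (j + m) ψ`. This is the Hairer–Mattingly form of
Harris' theorem for the (time-inhomogeneous, Markov) kernels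
`f ↦ P m (f * P j ψ) / P (j + m) ψ`, written without division since `P (j + m) ψ` may vanish. -/
theorem contraction (H : HarrisData P w k K ℓ y₀ r θ₁ θ₂ c₂ C) :
    ∃ (m : ℕ) (ε a : ℝ), 0 < m ∧ 0 < ε ∧ 0 < a ∧ a < 1 ∧ ∀ (j : ℕ) (f : LInfty ψ),
      (∀ x, |f.1 x| ≤ (P j w).1 x + ε * (r j * ψ x)) →
      ∃ c : ℝ, ∀ x, |(P m f).1 x - c * (P (j + m) w).1 x|
        ≤ a * ((P (j + m) w).1 x + ε * (r (j + m) * ψ x)) := by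
  have hC := H.C_pos
  have hc := H.c₂_pos
  have hθ := sub_pos.2 H.θ_lt
  have hq0 : 0 < θ₁ / θ₂ := div_pos H.θ₁_pos H.θ₂_pos
  have hq1 : θ₁ / θ₂ < 1 := (div_lt_one H.θ₂_pos).2 H.θ_lt
  set B := c₂ * C / (θ₂ - θ₁) with hB
  have hB0 : 0 < B := by positivity
  obtain ⟨m₀, hm₀⟩ := H.small_set (R := 16 * B) (by positivity)
  obtain ⟨m₁, hm₁⟩ := exists_pow_lt_of_lt_one (show (0 : ℝ) < 1 / 4 by norm_num) hq1
  set m := max m₀ m₁ + 1 with hm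
  obtain ⟨κ₀, hκ₀, hsmall₀⟩ := hm₀ m ((le_max_left _ _).trans (Nat.le_succ _))
  have hγ : (θ₁ / θ₂) ^ m ≤ 1 / 4 :=
    (pow_le_pow_of_le_one hq0.le hq1.le ((le_max_right m₀ m₁).trans (Nat.le_succ _))).trans hm₁.le
  -- the minorization constant may be decreased so that the contraction factor stays above `1 / 2`
  obtain ⟨κ, hκ, hκ1, hκle⟩ : ∃ κ : ℝ, 0 < κ ∧ κ ≤ 1 ∧ C * κ ≤ κ₀ :=
    ⟨min 1 (κ₀ / C), by positivity, min_le_left _ _,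
      (mul_le_mul_of_nonneg_left (min_le_right _ _) hC.le).trans (by field_simp; rfl)⟩
  -- `ε` makes the error `ε * B` of the Lyapunov inequality half the gain `κ`
  set ε := κ / (2 * B) with hε
  have hε0 : 0 < ε := by positivity
  have hεB : ε * B = κ / 2 := by rw [hε]; field_simp
  refine ⟨m, ε, 1 - κ / 2, Nat.succ_pos _, hε0, by linarith, by linarith, fun j f hf => ?_⟩
  set v : LInfty ψ := P j w + (ε * r j) • w with hv
  have hvx : ∀ x, v.1 x = (P j w).1 x + ε * (r j * ψ x) := fun x => by
    have : v.1 x = (P j w).1 x + (ε * r j) * w.1 x := rfl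
    rw [this, H.w_eq]; ring
  have hPv : ∀ x, (P m v).1 x = (P (j + m) w).1 x + ε * (r j * (P m w).1 x) := fun x => by
    have : P m v = P m (P j w) + (ε * r j) • P m w := by rw [hv, map_add, map_smul]
    rw [this, ← H.add, add_comm m j]
    change _ + (ε * r j) * _ = _
    ring
  have hrj := H.r_pos j
  have hrm := H.r_pos (j + m)
  have hu0 := H.u_nonneg (j + m)
  have hψ := H.weight_pos
  -- Lyapunov inequality for `v`
  have hPv_le : ∀ x, (P m v).1 x ≤
      (1 + κ / 2) * (P (j + m) w).1 x + ε / 4 * (r (j + m) * ψ x) := fun x => by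
    rw [hPv]
    have h1 := H.lyapunov m j x
    have h2 : (θ₁ / θ₂) ^ m * r (j + m) * ψ x ≤ 1 / 4 * r (j + m) * ψ x := by
      have := hψ x; gcongr
    calc (P (j + m) w).1 x + ε * (r j * (P m w).1 x)
        ≤ (P (j + m) w).1 x + ε * (1 / 4 * r (j + m) * ψ x + B * (P (j + m) w).1 x) := by
          gcongr; linarith
      _ = (1 + ε * B) * (P (j + m) w).1 x + ε / 4 * (r (j + m) * ψ x) := by ring
      _ = _ := by rw [hεB]
  have hPf : ∀ x, |(P m f).1 x| ≤ (P m v).1 x := fun x => by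
    have := (H.pos m).abs_le_smul (f := f) (g := v) (a := 1) (fun y => by
      rw [one_mul, hvx]; exact hf y) x
    rwa [one_mul] at this
  -- on the small set, a fixed multiple of `P (j + m) ψ` gains the factor `1 - κ / 2`
  set c₀ := κ₀ / r j * ℓ f with hc₀
  have hgood : ∀ x, r (j + m) * ψ x ≤ 16 * B * (P (j + m) w).1 x →
      |(P m f).1 x - c₀ * (P (j + m) w).1 x|
        ≤ (1 - κ / 2) * ((P (j + m) w).1 x + ε * (r (j + m) * ψ x)) := fun x hx => by
    have hu := hu0 x
    have hs := hsmall₀ j x hx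
    have hℓv : r j / C ≤ ℓ v := H.ℓ_lower v _ fun y hy => by
      have h1 := H.lower j y hy
      have h2 : 0 ≤ ε * (r j * ψ y) := by have := hψ y; positivity
      rw [hvx, div_mul_eq_mul_div, div_le_iff₀ hC]
      nlinarith
    have hbound : (P m v).1 x - κ₀ / r j * ℓ v * (P (j + m) w).1 x
        ≤ (1 - κ / 2) * ((P (j + m) w).1 x + ε * (r (j + m) * ψ x)) := by
      have h1 : κ * (P (j + m) w).1 x ≤ κ₀ / r j * ℓ v * (P (j + m) w).1 x := by
        refine mul_le_mul_of_nonneg_right ?_ hu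
        calc κ = C * κ / r j * (r j / C) := by field_simp
          _ ≤ κ₀ / r j * ℓ v := by gcongr
      have h2 : ε / 4 * (r (j + m) * ψ x) ≤ (1 - κ / 2) * (ε * (r (j + m) * ψ x)) := by
        have h3 : 0 ≤ ε * (r (j + m) * ψ x) := by have := hψ x; positivity
        nlinarith
      have := hPv_le x
      linarith
    have hdiv : ∀ g : LInfty ψ, (∀ y, 0 ≤ g.1 y) →
        κ₀ / r j * ℓ g * (P (j + m) w).1 x ≤ (P m g).1 x := fun g hg => by
      have := hs g hg
      rw [div_mul_eq_mul_div, div_mul_eq_mul_div, div_le_iff₀ hrj]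
      linarith
    have e1 := hdiv (v - f) fun y => by
      have := (le_abs_self _).trans (hf y)
      rw [← hvx] at this
      exact sub_nonneg.2 this
    have e2 := hdiv (v + f) fun y => by
      have := (neg_le_abs _).trans (hf y)
      rw [← hvx] at this
      change 0 ≤ v.1 y + f.1 y
      linarith
    rw [map_sub, map_sub] at e1
    rw [map_add ℓ v f, map_add (P m) v f] at e2
    have e1' : κ₀ / r j * (ℓ v - ℓ f) * (P (j + m) w).1 x ≤ (P m v).1 x - (P m f).1 x := e1
    have e2' : κ₀ / r j * (ℓ v + ℓ f) * (P (j + m) w).1 x ≤ (P m v).1 x + (P m f).1 x := e2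
    rw [abs_le, hc₀]
    constructor <;> linarith
  -- away from the small set the weight contracts, even before anything is subtracted
  have hbad : ∀ x, ¬ r (j + m) * ψ x ≤ 16 * B * (P (j + m) w).1 x → 0 < (P (j + m) w).1 x →
      2 * κ ≤ ε / 4 * (r (j + m) * ψ x / (P (j + m) w).1 x) := fun x hx hu => by
    have h1 : 16 * B ≤ r (j + m) * ψ x / (P (j + m) w).1 x :=
      (le_div_iff₀ hu).2 (not_le.1 hx).le
    calc 2 * κ = ε / 4 * (16 * B) := by linarith
      _ ≤ _ := by gcongr
  set u : E → ℝ := fun x => (P (j + m) w).1 x with hu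
  set s : E → ℝ := fun x => r (j + m) * ψ x / u x with hs
  have hs0 : ∀ x, 0 < u x → 0 < s x := fun x hx => by have := hψ x; positivity
  have hratio : ∀ x, 0 < u x → |(P m f).1 x / u x| ≤ 1 + κ / 2 + ε / 4 * s x := fun x hx => by
    rw [abs_div, abs_of_pos hx, div_le_iff₀ hx]
    refine ((hPf x).trans (hPv_le x)).trans_eq ?_
    simp only [hs, hu] at hx ⊢
    field_simp
  have hgood' : ∀ x, 0 < u x → r (j + m) * ψ x ≤ 16 * B * u x →
      |(P m f).1 x / u x - c₀| ≤ (1 - κ / 2) * (1 + ε * s x) := fun x hx h => by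
    have h1 := hgood x h
    have h2 : (P m f).1 x / u x - c₀ = ((P m f).1 x - c₀ * u x) / u x := by field_simp
    rw [h2, abs_div, abs_of_pos hx, div_le_iff₀ hx]
    refine h1.trans_eq ?_
    simp only [hs, hu] at hx ⊢
    field_simp
  have hpair : ∀ x, 0 < u x → ∀ y, 0 < u y →
      (P m f).1 x / u x - (1 - κ / 2) * (1 + ε * s x)
        ≤ (P m f).1 y / u y + (1 - κ / 2) * (1 + ε * s y) := fun x hx y hy => by
    have hsx := mul_pos hε0 (hs0 x hx)
    have hsy := mul_pos hε0 (hs0 y hy)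
    have ax := (abs_le.1 (hratio x hx)).2
    have ay := (abs_le.1 (hratio y hy)).1
    by_cases gx : r (j + m) * ψ x ≤ 16 * B * u x
    · by_cases gy : r (j + m) * ψ y ≤ 16 * B * u y
      · have bx := (abs_le.1 (hgood' x hx gx)).2
        have bz := (abs_le.1 (hgood' y hy gy)).1
        linarith
      · have := hbad y gy hy
        change 2 * κ ≤ ε / 4 * s y at this
        nlinarith
    · have := hbad x gx hx
      change 2 * κ ≤ ε / 4 * s x at this
      nlinarith
  obtain ⟨c, hc1, hc2⟩ := exists_between_of_forall_le
    (s := (fun x => (P m f).1 x / u x - (1 - κ / 2) * (1 + ε * s x)) '' {x | 0 < u x})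
    (t := (fun x => (P m f).1 x / u x + (1 - κ / 2) * (1 + ε * s x)) '' {x | 0 < u x})
    (Set.Nonempty.image _ ⟨y₀, H.u_pos _⟩) (Set.Nonempty.image _ ⟨y₀, H.u_pos _⟩)
    (by rintro _ ⟨x, hx, rfl⟩ _ ⟨y, hy, rfl⟩; exact hpair x hx y hy)
  refine ⟨c, fun x => ?_⟩
  rcases (hu0 x).eq_or_lt with h0 | h0
  · rw [← h0, mul_zero, sub_zero, zero_add]
    refine ((hPf x).trans (hPv_le x)).trans ?_
    rw [← h0]
    have h3 : 0 ≤ ε * (r (j + m) * ψ x) := by have := hψ x; positivity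
    nlinarith
  · have b1 := hc1 ⟨x, h0, rfl⟩
    have b2 := hc2 ⟨x, h0, rfl⟩
    have b3 : |(P m f).1 x / u x - c| ≤ (1 - κ / 2) * (1 + ε * s x) := by
      rw [abs_le]; constructor <;> simp only at b1 b2 <;> linarith
    have e1 : (P m f).1 x - c * u x = ((P m f).1 x / u x - c) * u x := by
      have : u x ≠ 0 := h0.ne'
      field_simp
    have e2 : (1 - κ / 2) * (u x + ε * (r (j + m) * ψ x))
        = (1 - κ / 2) * (1 + ε * s x) * u x := by
      have : u x ≠ 0 := h0.ne'
      simp only [hs]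
      field_simp
    change |(P m f).1 x - c * u x| ≤ (1 - κ / 2) * (u x + ε * (r (j + m) * ψ x))
    rw [e1, e2, abs_mul, abs_of_pos (show 0 < u x from h0)]
    exact mul_le_mul_of_nonneg_right b3 h0.le

/-- The normalised functional `f ↦ P n f (y₀) / P n ψ (y₀)`. -/
noncomputable def ratio (P : ℕ → LInfty ψ →ₗ[ℝ] LInfty ψ) (w : LInfty ψ) (y₀ : E) (n : ℕ)
    (f : LInfty ψ) : ℝ :=
  (P n f).1 y₀ / (P n w).1 y₀

/-- Up to a geometrically small error, `P n` has rank one. -/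
theorem rank_one (H : HarrisData P w k K ℓ y₀ r θ₁ θ₂ c₂ C) :
    ∃ (D α : ℝ), 0 < D ∧ 0 < α ∧ α < 1 ∧ ∀ (n : ℕ) (f : LInfty ψ), (∀ x, |f.1 x| ≤ ψ x) →
      ∀ x, |(P n f).1 x - ratio P w y₀ n f * (P n w).1 x| ≤ D * α ^ n * r n * ψ x := by
  obtain ⟨m, ε, a, hm, hε, ha0, ha1, hcon⟩ := H.contraction
  have hC := H.C_pos
  have iter : ∀ (q s : ℕ) (f : LInfty ψ), (∀ x, |f.1 x| ≤ ψ x) →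
      ∃ c : ℝ, ∀ x, |(P (s + m * q) f).1 x - c * (P (s + m * q) w).1 x|
        ≤ a ^ q * ((P (s + m * q) w).1 x + ε * (r (s + m * q) * ψ x)) := by
    intro q s f hf
    induction q with
    | zero =>
      refine ⟨0, fun x => ?_⟩
      have h1 := (H.pos s).abs_le_smul (f := f) (g := w) (a := 1)
        (fun y => by rw [H.w_eq, one_mul]; exact hf y) x
      have h2 : 0 ≤ ε * (r s * ψ x) := by
        have := H.weight_pos x; have := H.r_pos s; positivity
      simp only [mul_zero, add_zero, zero_mul, sub_zero, pow_zero, one_mul] at h1 ⊢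
      linarith
    | succ q ih =>
      obtain ⟨c, hc⟩ := ih
      set j := s + m * q with hj
      have haq : 0 < a ^ q := by positivity
      obtain ⟨c', hc'⟩ := hcon j ((a ^ q)⁻¹ • (P j f - c • P j w)) fun x => by
        change |(a ^ q)⁻¹ * ((P j f).1 x - c * (P j w).1 x)| ≤ _
        rw [abs_mul, abs_of_pos (inv_pos.2 haq), inv_mul_le_iff₀ haq]
        exact hc x
      refine ⟨c + a ^ q * c', fun x => ?_⟩
      rw [show s + m * (q + 1) = j + m by rw [hj]; ring]
      have h := hc' x
      rw [map_smul, map_sub, map_smul, ← H.add, ← H.add, add_comm m j] at h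
      change |(a ^ q)⁻¹ * ((P (j + m) f).1 x - c * (P (j + m) w).1 x)
        - c' * (P (j + m) w).1 x| ≤ _ at h
      have e : (P (j + m) f).1 x - (c + a ^ q * c') * (P (j + m) w).1 x
          = a ^ q * ((a ^ q)⁻¹ * ((P (j + m) f).1 x - c * (P (j + m) w).1 x)
            - c' * (P (j + m) w).1 x) := by field_simp; ring
      rw [e, abs_mul, abs_of_pos haq, pow_succ, mul_assoc]
      exact mul_le_mul_of_nonneg_left h haq.le
  obtain ⟨α, hα0, hα1, hpow⟩ := exists_pow_div_le_geometric ha0 ha1 hm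
  set D₁ := (C + ε) / α ^ m with hD₁
  have hD₁0 : 0 < D₁ := by positivity
  refine ⟨D₁ + D₁ * C * C, α, by positivity, hα0, hα1, fun n f hf x => ?_⟩
  obtain ⟨c, hc⟩ := iter (n / m) (n % m) f hf
  rw [Nat.mod_add_div] at hc
  have hrn := H.r_pos n
  have hc₁ : ∀ y, |(P n f).1 y - c * (P n w).1 y| ≤ D₁ * α ^ n * (r n * ψ y) := fun y => by
    have := H.weight_pos y
    calc _ ≤ a ^ (n / m) * ((P n w).1 y + ε * (r n * ψ y)) := hc y
      _ ≤ (α ^ n / α ^ m) * (C * r n * ψ y + ε * (r n * ψ y)) :=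
          mul_le_mul (hpow n) (by linarith [H.upper n y])
            (add_nonneg (H.u_nonneg _ _) (by positivity)) (by positivity)
      _ = _ := by rw [hD₁]; field_simp
  have hu := H.u_pos n
  have hdiff : |ratio P w y₀ n f - c| ≤ D₁ * α ^ n * C := by
    have e : ratio P w y₀ n f - c = ((P n f).1 y₀ - c * (P n w).1 y₀) / (P n w).1 y₀ := by
      unfold ratio; field_simp
    rw [e, abs_div, abs_of_pos hu, div_le_iff₀ hu]
    refine (hc₁ y₀).trans ?_
    rw [mul_assoc (D₁ * α ^ n)]
    exact mul_le_mul_of_nonneg_left (H.lower n y₀ H.mem) (by positivity)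
  have e : (P n f).1 x - ratio P w y₀ n f * (P n w).1 x
      = ((P n f).1 x - c * (P n w).1 x) - (ratio P w y₀ n f - c) * (P n w).1 x := by ring
  rw [e]
  refine (abs_sub _ _).trans ?_
  rw [abs_mul, abs_of_nonneg (H.u_nonneg n x)]
  calc _ ≤ D₁ * α ^ n * (r n * ψ x) + D₁ * α ^ n * C * (C * r n * ψ x) :=
        add_le_add (hc₁ x) (mul_le_mul hdiff (H.upper n x) (H.u_nonneg n x) (by positivity))
    _ = _ := by ring

end HarrisData

/-! ### Limits of measures that are Cauchy in total variation -/

/-- A sequence of probability measures that is Cauchy in total variation (at a geometric rate)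
converges: with respect to a common dominating measure the densities converge in `L¹`. -/
theorem exists_tendsto_integral_of_geometric
    (ρ : ℕ → Measure E) [∀ n, IsProbabilityMeasure (ρ n)] {D α : ℝ} (hα1 : α < 1)
    (h : ∀ (n : ℕ) (g : E → ℝ), Measurable g → (∀ x, |g x| ≤ 1) →
      |∫ x, g x ∂(ρ (n + 1)) - ∫ x, g x ∂(ρ n)| ≤ D * α ^ n) :
    ∃ ν : Measure E, IsFiniteMeasure ν ∧ ∀ g : E → ℝ, Measurable g → (∀ x, |g x| ≤ 1) →
      Filter.Tendsto (fun n => ∫ x, g x ∂(ρ n)) Filter.atTop (nhds (∫ x, g x ∂ν)) := by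
  obtain ⟨π, hπ, hπ1, -⟩ := exists_isFiniteMeasure_absolutelyContinuous (Measure.sum ρ)
  have hac : ∀ n, ρ n ≪ π := fun n =>
    (Measure.absolutelyContinuous_of_le (Measure.le_sum ρ n)).trans hπ1
  set F : ℕ → E → ℝ := fun n x => ((ρ n).rnDeriv π x).toReal with hF
  have hFm : ∀ n, Measurable (F n) := fun n => (Measure.measurable_rnDeriv _ _).ennreal_toReal
  have hFi : ∀ n, Integrable (F n) π := fun n => Measure.integrable_toReal_rnDeriv
  have hFint : ∀ n (g : E → ℝ), ∫ x, F n x * g x ∂π = ∫ x, g x ∂(ρ n) := fun n g => by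
    simpa [smul_eq_mul] using integral_rnDeriv_smul (hac n) (f := g)
  have hmul : ∀ (G : E → ℝ) (g : E → ℝ), Integrable G π → Measurable g → (∀ x, |g x| ≤ 1) →
      Integrable (fun x => G x * g x) π := fun G g hG hg hb =>
    hG.mul_bdd (c := 1) hg.aestronglyMeasurable (Filter.Eventually.of_forall hb)
  have hdist : ∀ n, dist ((hFi n).toL1 (F n)) ((hFi (n + 1)).toL1 (F (n + 1))) ≤ D * α ^ n := by
    intro n
    rw [dist_comm, dist_eq_norm, ← Integrable.toL1_sub _ _ (hFi (n + 1)) (hFi n),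
      L1.norm_of_fun_eq_integral_norm]
    -- test against the sign of the difference of the densities
    set g : E → ℝ := fun x => SignType.sign (F (n + 1) x - F n x) with hg
    have hgm : Measurable g := by
      have : g = fun x => Set.indicator {x | F n x < F (n + 1) x} (fun _ => (1 : ℝ)) x
          - Set.indicator {x | F (n + 1) x < F n x} (fun _ => (1 : ℝ)) x := by
        funext x
        rcases lt_trichotomy (F n x) (F (n + 1) x) with hx | hx | hx
        · simp [hg, Set.indicator, hx, not_lt.2 hx.le]
        · simp [hg, Set.indicator, hx]
        · simp [hg, Set.indicator, hx, not_lt.2 hx.le]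
      rw [this]
      exact (measurable_const.indicator (measurableSet_lt (hFm _) (hFm _))).sub
        (measurable_const.indicator (measurableSet_lt (hFm _) (hFm _)))
    have hgb : ∀ x, |g x| ≤ 1 := fun x => by
      rcases lt_trichotomy (F (n + 1) x - F n x) 0 with hx | hx | hx
      · simp [hg, hx]
      · simp [hg, hx]
      · simp [hg, hx]
    have e : ∫ x, ‖F (n + 1) x - F n x‖ ∂π = ∫ x, g x ∂(ρ (n + 1)) - ∫ x, g x ∂(ρ n) := by
      rw [← hFint, ← hFint, ← integral_sub (hmul _ _ (hFi _) hgm hgb) (hmul _ _ (hFi _) hgm hgb)]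
      refine integral_congr_ae (Filter.Eventually.of_forall fun x => ?_)
      simp only [hg]
      rw [← sub_mul, Real.norm_eq_abs, self_mul_sign]
    change ∫ x, ‖F (n + 1) x - F n x‖ ∂π ≤ _
    rw [e]
    exact (le_abs_self _).trans (h n g hgm hgb)
  obtain ⟨L, hL⟩ := cauchySeq_tendsto_of_complete (cauchySeq_of_le_geometric α D hα1 hdist)
  have hLi : Integrable L π := L1.integrable_coeFn L
  refine ⟨π.withDensity fun x => ENNReal.ofReal |L x|,
    isFiniteMeasure_withDensity_ofReal hLi.abs.2, fun g hgm hgb => ?_⟩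
  have hlim : ∫ x, g x ∂(π.withDensity fun x => ENNReal.ofReal |L x|) = ∫ x, |L x| * g x ∂π := by
    rw [integral_withDensity_eq_integral_toReal_smul₀
      (hLi.abs.aestronglyMeasurable.aemeasurable.ennreal_ofReal)
      (Filter.Eventually.of_forall fun x => ENNReal.ofReal_lt_top)]
    simp [ENNReal.toReal_ofReal, smul_eq_mul]
  rw [hlim]
  rw [tendsto_iff_dist_tendsto_zero] at hL ⊢
  refine squeeze_zero (fun _ => dist_nonneg) (fun n => ?_) hL
  rw [← hFint, Real.dist_eq, ← integral_sub (hmul _ _ (hFi _) hgm hgb) (hmul _ _ hLi.abs hgm hgb),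
    dist_eq_norm]
  have e : ‖(hFi n).toL1 (F n) - L‖ = ∫ x, ‖F n x - L x‖ ∂π := by
    rw [L1.norm_eq_integral_norm]
    refine integral_congr_ae ?_
    filter_upwards [Lp.coeFn_sub ((hFi n).toL1 (F n)) L, (hFi n).coeFn_toL1] with x hx hx'
    rw [hx, Pi.sub_apply, hx']
  rw [e, ← Real.norm_eq_abs]
  refine norm_integral_le_of_norm_le ((hFi n).sub hLi).norm (Filter.Eventually.of_forall fun x => ?_)
  rw [← sub_mul, norm_mul]
  have h1 : ‖g x‖ ≤ 1 := hgb x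
  have h2 : ‖F n x - |L x|‖ ≤ ‖F n x - L x‖ := by
    have := abs_abs_sub_abs_le (F n x) (L x)
    rwa [abs_of_nonneg (show 0 ≤ F n x from ENNReal.toReal_nonneg)] at this
  calc _ ≤ ‖F n x - |L x|‖ * 1 := by gcongr
    _ ≤ _ := by rw [mul_one]; exact h2

theorem LInfty.exists_abs_le (hpos : ∀ x, 0 < ψ x) (f : LInfty ψ) :
    ∃ b : ℝ, 0 < b ∧ ∀ x, |f.1 x| ≤ b * ψ x := by
  obtain ⟨b, hb⟩ := f.2.2
  refine ⟨max b 1, by positivity, fun x => (hb x).trans ?_⟩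
  exact mul_le_mul_of_nonneg_right (le_max_left _ _) (hpos x).le

theorem LInfty.integrable {μ : Measure E} (hμ : Integrable ψ μ) (f : LInfty ψ) :
    Integrable f.1 μ := by
  obtain ⟨b, hb⟩ := f.2.2
  exact (hμ.const_mul b).mono' f.2.1.aestronglyMeasurable (Filter.Eventually.of_forall hb)

theorem integral_withDensity_weight (hψ : Measurable ψ) (hpos : ∀ x, 0 < ψ x) (μ : Measure E)
    (g : E → ℝ) :
    ∫ x, g x ∂(μ.withDensity fun x => ENNReal.ofReal (ψ x)) = ∫ x, ψ x * g x ∂μ := by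
  rw [integral_withDensity_eq_integral_toReal_smul hψ.ennreal_ofReal
    (Filter.Eventually.of_forall fun x => ENNReal.ofReal_lt_top)]
  simp [ENNReal.toReal_ofReal (hpos _).le, smul_eq_mul]

/-- Weighted version of `exists_tendsto_integral_of_geometric`: the limit exists in the dual of
`L^∞(ψ)` and is a measure. -/
theorem exists_tendsto_integral_weighted (hψ : Measurable ψ) (hpos : ∀ x, 0 < ψ x)
    (μ : ℕ → Measure E) (hi : ∀ n, Integrable ψ (μ n)) (h1 : ∀ n, ∫ x, ψ x ∂(μ n) = 1)
    {D α : ℝ} (hα1 : α < 1)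
    (h : ∀ (n : ℕ) (f : LInfty ψ), (∀ x, |f.1 x| ≤ ψ x) →
      |∫ x, f.1 x ∂(μ (n + 1)) - ∫ x, f.1 x ∂(μ n)| ≤ D * α ^ n) :
    ∃ ν : Measure E, Integrable ψ ν ∧ ∀ f : LInfty ψ,
      Filter.Tendsto (fun n => ∫ x, f.1 x ∂(μ n)) Filter.atTop (nhds (∫ x, f.1 x ∂ν)) := by
  set ρ : ℕ → Measure E := fun n => (μ n).withDensity fun x => ENNReal.ofReal (ψ x) with hρ
  have hprob : ∀ n, IsProbabilityMeasure (ρ n) := fun n => by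
    constructor
    rw [hρ]
    simp only [withDensity_apply _ MeasurableSet.univ, Measure.restrict_univ]
    rw [← ofReal_integral_eq_lintegral_ofReal (hi n)
      (Filter.Eventually.of_forall fun x => (hpos x).le), h1, ENNReal.ofReal_one]
  obtain ⟨ν, hν, hlim⟩ := exists_tendsto_integral_of_geometric ρ (D := D) hα1
    (fun n g hg hb => by
      rw [hρ]
      simp only [integral_withDensity_weight hψ hpos]
      refine h n ⟨fun x => ψ x * g x, hψ.mul hg, 1, fun x => ?_⟩ fun x => ?_
      all_goals
        rw [abs_mul, abs_of_pos (hpos x)]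
        nlinarith [hb x, hpos x])
  have hinv : Measurable fun x => (ψ x)⁻¹ := hψ.inv
  have hinvpos : ∀ x, 0 < (ψ x)⁻¹ := fun x => inv_pos.2 (hpos x)
  refine ⟨ν.withDensity fun x => ENNReal.ofReal ((ψ x)⁻¹), ?_, fun f => ?_⟩
  · rw [integrable_withDensity_iff_integrable_smul' hinv.ennreal_ofReal
      (Filter.Eventually.of_forall fun x => ENNReal.ofReal_lt_top)]
    refine (integrable_const (1 : ℝ)).congr (Filter.Eventually.of_forall fun x => ?_)
    simp only [ENNReal.toReal_ofReal (hinvpos x).le, smul_eq_mul]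
    exact (inv_mul_cancel₀ (hpos x).ne').symm
  · obtain ⟨b, hb, hfb⟩ := LInfty.exists_abs_le hpos f
    have hfm : Measurable f.1 := f.2.1
    have := (hlim (fun x => b⁻¹ * ((ψ x)⁻¹ * f.1 x)) ((hinv.mul hfm).const_mul _) fun x => by
      rw [abs_mul, abs_mul, abs_of_pos (inv_pos.2 hb), abs_of_pos (hinvpos x)]
      have := hfb x
      have hx := hpos x
      rw [inv_mul_le_iff₀ hb, inv_mul_le_iff₀ hx]
      linarith).const_mul b
    rw [integral_withDensity_weight hinv hinvpos]
    have e1 : ∀ n, b * ∫ x, b⁻¹ * ((ψ x)⁻¹ * f.1 x) ∂(ρ n) = ∫ x, f.1 x ∂(μ n) := fun n => by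
      rw [integral_const_mul, mul_inv_cancel_left₀ hb.ne', hρ]
      simp only [integral_withDensity_weight hψ hpos]
      refine integral_congr_ae (Filter.Eventually.of_forall fun x => ?_)
      exact mul_inv_cancel_left₀ (hpos x).ne' _
    have e2 : b * ∫ x, b⁻¹ * ((ψ x)⁻¹ * f.1 x) ∂ν = ∫ x, (ψ x)⁻¹ * f.1 x ∂ν := by
      rw [integral_const_mul, mul_inv_cancel_left₀ hb.ne']
    simp only [e1, e2] at this
    exact this

/-! ### The leading eigenvalue, eigenmeasure and eigenfunction -/

namespace HarrisData

variable {P : ℕ → LInfty ψ →ₗ[ℝ] LInfty ψ} {w k : LInfty ψ} {K : Set E}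
    {ℓ : LInfty ψ →ₗ[ℝ] ℝ} {y₀ : E} {r : ℕ → ℝ} {θ₁ θ₂ c₂ C : ℝ}

theorem abs_apply_le (H : HarrisData P w k K ℓ y₀ r θ₁ θ₂ c₂ C) {f : LInfty ψ} {b : ℝ}
    (hf : ∀ x, |f.1 x| ≤ b * ψ x) (n : ℕ) (x : E) : |(P n f).1 x| ≤ b * (P n w).1 x :=
  (H.pos n).abs_le_smul (fun y => by rw [H.w_eq]; exact hf y) x

theorem rank_one_scaled {D α : ℝ} {n : ℕ}
    (h : ∀ f : LInfty ψ, (∀ x, |f.1 x| ≤ ψ x) →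
      ∀ x, |(P n f).1 x - ratio P w y₀ n f * (P n w).1 x| ≤ D * α ^ n * r n * ψ x)
    {f : LInfty ψ} {b : ℝ} (hb : 0 < b) (hf : ∀ x, |f.1 x| ≤ b * ψ x) (x : E) :
    |(P n f).1 x - ratio P w y₀ n f * (P n w).1 x| ≤ D * α ^ n * r n * b * ψ x := by
  have h1 := h (b⁻¹ • f) (fun y => by
    change |b⁻¹ * f.1 y| ≤ _
    rw [abs_mul, abs_of_pos (inv_pos.2 hb), inv_mul_le_iff₀ hb]
    exact hf y) x
  have e1 : (P n (b⁻¹ • f)).1 x = b⁻¹ * (P n f).1 x := by rw [map_smul]; rfl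
  have e2 : ratio P w y₀ n (b⁻¹ • f) = b⁻¹ * ratio P w y₀ n f := by
    unfold ratio
    rw [map_smul]
    change b⁻¹ * _ / _ = _
    ring
  rw [e1, e2, mul_assoc, ← mul_sub, abs_mul, abs_of_pos (inv_pos.2 hb), inv_mul_le_iff₀ hb] at h1
  linarith

/-- The normalised functionals form a Cauchy sequence in the dual of `L^∞(ψ)`. -/
theorem ratio_cauchy (H : HarrisData P w k K ℓ y₀ r θ₁ θ₂ c₂ C) {D α : ℝ} (hD : 0 < D)
    (hα : 0 < α)
    (h : ∀ (n : ℕ) (f : LInfty ψ), (∀ x, |f.1 x| ≤ ψ x) →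
      ∀ x, |(P n f).1 x - ratio P w y₀ n f * (P n w).1 x| ≤ D * α ^ n * r n * ψ x) :
    ∃ D' : ℝ, 0 < D' ∧ ∀ (n j : ℕ) (f : LInfty ψ), (∀ x, |f.1 x| ≤ ψ x) →
      |ratio P w y₀ (n + j) f - ratio P w y₀ n f| ≤ D' * α ^ n := by
  have hC := H.C_pos
  have hc := H.c₂_pos
  have hθ := sub_pos.2 H.θ_lt
  set A := C * (1 + c₂ * C / (θ₂ - θ₁) * C) with hA
  have hA0 : 0 < A := by positivity
  refine ⟨D * C * C * A, by positivity, fun n j f hf => ?_⟩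
  have hu := H.u_pos (n + j)
  have hrn := H.r_pos n
  have hrj := H.r_pos j
  have h1 := H.abs_apply_le (f := P n f - ratio P w y₀ n f • P n w) (b := D * α ^ n * r n)
    (h n f hf) j y₀
  rw [map_sub, map_smul, ← H.add, ← H.add, add_comm j n] at h1
  change |(P (n + j) f).1 y₀ - ratio P w y₀ n f * (P (n + j) w).1 y₀| ≤ _ at h1
  have e : ratio P w y₀ (n + j) f - ratio P w y₀ n f
      = ((P (n + j) f).1 y₀ - ratio P w y₀ n f * (P (n + j) w).1 y₀) / (P (n + j) w).1 y₀ := by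
    rw [sub_div, mul_div_assoc, div_self hu.ne', mul_one]; rfl
  rw [e, abs_div, abs_of_pos hu, div_le_iff₀ hu]
  have hψ := H.weight_pos y₀
  calc _ ≤ D * α ^ n * r n * (P j w).1 y₀ := h1
    _ ≤ D * α ^ n * r n * (C * r j * ψ y₀) := by gcongr; exact H.upper j y₀
    _ = D * α ^ n * C * (r n * r j) * ψ y₀ := by ring
    _ ≤ D * α ^ n * C * (A * r (n + j)) * ψ y₀ := by
        gcongr D * α ^ n * C * ?_ * ψ y₀; exact H.r_mul_le n j
    _ = D * α ^ n * C * A * (r (n + j) * ψ y₀) := by ring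
    _ ≤ D * α ^ n * C * A * (C * (P (n + j) w).1 y₀) := by
        gcongr D * α ^ n * C * A * ?_; exact H.lower _ y₀ H.mem
    _ = _ := by ring

/-- The leading eigenelements of a semigroup satisfying `HarrisData`, and convergence of the
normalised semigroup. The sequence `r` turns out to be comparable to `θ₀ ^ n`. -/
theorem exists_eigen (H : HarrisData P w k K ℓ y₀ r θ₁ θ₂ c₂ C) (hψ : Measurable ψ)
    (μ : ℕ → Measure E)
    (hμ : ∀ n (f : LInfty ψ), Integrable f.1 (μ n) ∧ (P n f).1 y₀ = ∫ x, f.1 x ∂(μ n)) :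
    ∃ νP : Measure E, Integrable ψ νP ∧ ∫ x, ψ x ∂νP = 1 ∧ ∃ θ₀ : ℝ, 0 < θ₀ ∧
      (∀ (n : ℕ) (f : LInfty ψ), ∫ x, (P n f).1 x ∂νP = θ₀ ^ n * ∫ x, f.1 x ∂νP) ∧
      (∃ A : ℝ, 0 < A ∧ ∀ n, θ₀ ^ n ≤ A * r n ∧ r n ≤ A * θ₀ ^ n) ∧
      ∃ η : LInfty ψ, (∀ x, 0 ≤ η.1 x) ∧ P 1 η = θ₀ • η ∧ ∫ x, η.1 x ∂νP = 1 ∧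
      ∃ D α : ℝ, 0 < D ∧ 0 < α ∧ α < 1 ∧
        (∀ n x, |(θ₀ ^ n)⁻¹ * (P n w).1 x - η.1 x| ≤ D * α ^ n * ψ x) ∧
        ∀ (n : ℕ) (f : LInfty ψ), (∀ x, |f.1 x| ≤ ψ x) → ∀ x,
          |(θ₀ ^ n)⁻¹ * (P n f).1 x - η.1 x * ∫ y, f.1 y ∂νP| ≤ D * α ^ n * ψ x := by
  obtain ⟨D, α, hD, hα0, hα1, hrank⟩ := H.rank_one
  obtain ⟨D', hD', hcau⟩ := H.ratio_cauchy hD hα0 hrank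
  have hC := H.C_pos
  have hc := H.c₂_pos
  have hθ := sub_pos.2 H.θ_lt
  set A := C * (1 + c₂ * C / (θ₂ - θ₁) * C) with hA
  have hA0 : 0 < A := by positivity
  have hwψ : w.1 = ψ := funext H.w_eq
  -- the normalised functionals are integrals
  set ρ : ℕ → Measure E := fun n => ENNReal.ofReal ((P n w).1 y₀)⁻¹ • μ n with hρ
  have hρint : ∀ n (f : LInfty ψ), ∫ x, f.1 x ∂(ρ n) = ratio P w y₀ n f := fun n f => by
    rw [hρ]
    simp only [integral_smul_measure, ENNReal.toReal_ofReal (inv_nonneg.2 (H.u_nonneg n y₀)),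
      smul_eq_mul]
    rw [← (hμ n f).2, ratio, div_eq_inv_mul]
  have hself : ∀ n, ratio P w y₀ n w = 1 := fun n => div_self (H.u_pos n).ne'
  obtain ⟨νP, hνi, hνlim⟩ := exists_tendsto_integral_weighted hψ H.weight_pos ρ
    (fun n => by
      have := (hμ n w).1
      rw [hwψ] at this
      exact this.smul_measure ENNReal.ofReal_ne_top)
    (fun n => by have := hρint n w; rwa [hself, hwψ] at this) (D := D') hα1
    (fun n f hf => by rw [hρint, hρint]; exact hcau n 1 f hf)
  simp only [hρint] at hνlim
  set c : LInfty ψ → ℝ := fun f => ∫ x, f.1 x ∂νP with hcdef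
  have hcw : c w = 1 := by
    refine tendsto_nhds_unique (hνlim w) ?_
    simp only [hself]
    exact tendsto_const_nhds
  have hclose : ∀ n (f : LInfty ψ), (∀ x, |f.1 x| ≤ ψ x) →
      |c f - ratio P w y₀ n f| ≤ D' * α ^ n := fun n f hf => by
    have h1 : Filter.Tendsto (fun j => ratio P w y₀ (n + j) f) Filter.atTop (nhds (c f)) := by
      have := (Filter.tendsto_add_atTop_iff_nat n).2 (hνlim f)
      simpa only [add_comm] using this
    exact le_of_tendsto ((h1.sub_const _).abs)
      (Filter.Eventually.of_forall fun j => hcau n j f hf)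
  have hmono : ∀ f g : LInfty ψ, (∀ x, f.1 x ≤ g.1 x) → c f ≤ c g := fun f g h =>
    integral_mono (LInfty.integrable hνi f) (LInfty.integrable hνi g) h
  have hratio_u : ∀ n j (f : LInfty ψ), ratio P w y₀ n (P j f)
      = ratio P w y₀ (n + j) f * ratio P w y₀ n (P j w) := fun n j f => by
    have h1 := (H.u_pos (n + j)).ne'
    simp only [ratio, ← H.add]
    field_simp
  -- `c` is multiplicative along the semigroup
  have hcmul : ∀ j (f : LInfty ψ), c (P j f) = c f * c (P j w) := fun j f => by
    refine tendsto_nhds_unique (hνlim (P j f)) ?_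
    simp only [hratio_u _ j f]
    exact ((Filter.tendsto_add_atTop_iff_nat j).2 (hνlim f)).mul (hνlim (P j w))
  set θ₀ := c (P 1 w) with hθ₀
  have hcpow : ∀ n, c (P n w) = θ₀ ^ n := fun n => by
    induction n with
    | zero => rw [H.zero, hcw, pow_zero]
    | succ n ih => rw [add_comm, H.add, hcmul, ih, pow_add, pow_one, mul_comm]
  have hup : ∀ n, θ₀ ^ n ≤ C * r n := fun n => by
    rw [← hcpow]
    have := hmono (P n w) ((C * r n) • w) (fun x => by
      change _ ≤ C * r n * w.1 x
      rw [H.w_eq]; exact H.upper n x)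
    refine this.trans_eq ?_
    change ∫ x, C * r n * w.1 x ∂νP = _
    rw [integral_const_mul]
    change C * r n * c w = _
    rw [hcw, mul_one]
  have hlow : ∀ n, r n ≤ C * C * A * θ₀ ^ n := fun n => by
    rw [← hcpow]
    have hCA : 0 < C * C * A := by positivity
    rw [← div_le_iff₀' hCA]
    refine ge_of_tendsto (hνlim (P n w)) (Filter.Eventually.of_forall fun j => ?_)
    have hu := H.u_pos j
    have hrj := H.r_pos j
    have hrn := H.r_pos n
    have hψ0 := H.weight_pos y₀
    rw [ratio, ← H.add, div_le_div_iff₀ hCA hu]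
    calc r n * (P j w).1 y₀ ≤ r n * (C * r j * ψ y₀) := by gcongr; exact H.upper j y₀
      _ = C * (r j * r n) * ψ y₀ := by ring
      _ ≤ C * (A * r (j + n)) * ψ y₀ := by
          gcongr C * ?_ * ψ y₀; exact H.r_mul_le j n
      _ = C * A * (r (j + n) * ψ y₀) := by ring
      _ ≤ C * A * (C * (P (j + n) w).1 y₀) := by
          gcongr C * A * ?_; exact H.lower _ y₀ H.mem
      _ = _ := by ring
  have hθ₀pos : 0 < θ₀ := by
    have h1 := hlow 1
    have h2 := H.r_pos 1
    rw [pow_one] at h1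
    exact pos_of_mul_pos_right (h2.trans_le h1) (by positivity)
  set A' := C * C * A with hA'
  have hA'0 : 0 < A' := by positivity
  -- the normalised functions `g n = θ₀ ^ (-n) P n ψ`
  set g : ℕ → LInfty ψ := fun n => (θ₀ ^ n)⁻¹ • P n w with hg
  have hgx : ∀ n x, (g n).1 x = (θ₀ ^ n)⁻¹ * (P n w).1 x := fun n x => rfl
  have hg0 : ∀ n x, 0 ≤ (g n).1 x := fun n x => by
    rw [hgx]; exact mul_nonneg (by positivity) (H.u_nonneg n x)
  have hg_le : ∀ n x, (g n).1 x ≤ C * A' * ψ x := fun n x => by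
    have hψx := H.weight_pos x
    rw [hgx, inv_mul_le_iff₀ (by positivity)]
    calc _ ≤ C * r n * ψ x := H.upper n x
      _ ≤ C * (A' * θ₀ ^ n) * ψ x := by gcongr; exact hlow n
      _ = _ := by ring
  set G := (D + D' * C) * C * A' * A' with hG
  have hG0 : 0 < G := by positivity
  have hgcau : ∀ n j x, |(g (n + j)).1 x - (g n).1 x| ≤ G * α ^ n * ψ x := fun n j x => by
    have hψx := H.weight_pos x
    have hrn := H.r_pos n
    have hrj := H.r_pos j
    have hb : ∀ y, |(P j w).1 y| ≤ C * r j * ψ y := fun y => by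
      rw [abs_of_nonneg (H.u_nonneg j y)]; exact H.upper j y
    have hCr : 0 < C * r j := by positivity
    have h1 := rank_one_scaled (hrank n) hCr hb x
    rw [← H.add] at h1
    have h2 : |θ₀ ^ j - ratio P w y₀ n (P j w)| ≤ C * r j * (D' * α ^ n) := by
      have := hclose n ((C * r j)⁻¹ • P j w) (fun y => by
        change |(C * r j)⁻¹ * (P j w).1 y| ≤ _
        rw [abs_mul, abs_of_pos (inv_pos.2 hCr), inv_mul_le_iff₀ hCr]
        exact hb y)
      have e1 : c ((C * r j)⁻¹ • P j w) = (C * r j)⁻¹ * θ₀ ^ j := by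
        rw [← hcpow, hcdef]
        exact integral_const_mul _ _
      have e2 : ratio P w y₀ n ((C * r j)⁻¹ • P j w)
          = (C * r j)⁻¹ * ratio P w y₀ n (P j w) := by
        unfold ratio
        rw [map_smul]
        exact mul_div_assoc _ _ _
      rwa [e1, e2, ← mul_sub, abs_mul, abs_of_pos (inv_pos.2 hCr), inv_mul_le_iff₀ hCr] at this
    have h3 : |(P (n + j) w).1 x - θ₀ ^ j * (P n w).1 x|
        ≤ (D + D' * C) * C * α ^ n * (r n * r j) * ψ x := by
      have e : (P (n + j) w).1 x - θ₀ ^ j * (P n w).1 x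
          = ((P (n + j) w).1 x - ratio P w y₀ n (P j w) * (P n w).1 x)
            - (θ₀ ^ j - ratio P w y₀ n (P j w)) * (P n w).1 x := by ring
      rw [e]
      refine (abs_sub _ _).trans ?_
      rw [abs_mul, abs_of_nonneg (H.u_nonneg n x)]
      calc _ ≤ D * α ^ n * r n * (C * r j) * ψ x + C * r j * (D' * α ^ n) * (C * r n * ψ x) :=
            add_le_add h1 (mul_le_mul h2 (H.upper n x) (H.u_nonneg n x) (by positivity))
        _ = _ := by ring
    have e : (g (n + j)).1 x - (g n).1 x
        = (θ₀ ^ (n + j))⁻¹ * ((P (n + j) w).1 x - θ₀ ^ j * (P n w).1 x) := by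
      rw [hgx, hgx, pow_add]; field_simp
    rw [e, abs_mul, abs_of_pos (by positivity), inv_mul_le_iff₀ (by positivity)]
    refine h3.trans ?_
    calc _ ≤ (D + D' * C) * C * α ^ n * (A' * θ₀ ^ n * (A' * θ₀ ^ j)) * ψ x := by
          gcongr
          · exact hlow n
          · exact hlow j
      _ = _ := by rw [hG, pow_add]; ring
  have hex : ∀ x, ∃ l, Filter.Tendsto (fun n => (g n).1 x) Filter.atTop (nhds l) := fun x => by
    refine cauchySeq_tendsto_of_complete (cauchySeq_of_le_geometric α (G * ψ x) hα1 fun n => ?_)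
    rw [dist_comm, Real.dist_eq]
    refine (hgcau n 1 x).trans_eq (by ring)
  choose e he using hex
  have he_close : ∀ n x, |(g n).1 x - e x| ≤ G * α ^ n * ψ x := fun n x => by
    rw [abs_sub_comm]
    have h1 : Filter.Tendsto (fun j => (g (n + j)).1 x) Filter.atTop (nhds (e x)) := by
      have := (Filter.tendsto_add_atTop_iff_nat n).2 (he x)
      simpa only [add_comm] using this
    exact le_of_tendsto ((h1.sub_const _).abs) (Filter.Eventually.of_forall fun j => hgcau n j x)
  have he0 : ∀ x, 0 ≤ e x := fun x => ge_of_tendsto' (he x) fun n => hg0 n x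
  have he_le : ∀ x, e x ≤ C * A' * ψ x := fun x => le_of_tendsto' (he x) fun n => hg_le n x
  set η : LInfty ψ := ⟨e, measurable_of_tendsto_metrizable (fun n => (g n).2.1)
    (tendsto_pi_nhds.2 he), C * A', fun x => by rw [abs_of_nonneg (he0 x)]; exact he_le x⟩ with hη
  have hαlim : Filter.Tendsto (fun n => α ^ n) Filter.atTop (nhds 0) :=
    tendsto_pow_atTop_nhds_zero_of_lt_one hα0.le hα1
  have hcg : ∀ n, c (g n) = 1 := fun n => by
    have : c (g n) = (θ₀ ^ n)⁻¹ * c (P n w) := integral_const_mul _ _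
    rw [this, hcpow, inv_mul_cancel₀ (by positivity)]
  have hcη : c η = 1 := by
    have h1 : ∀ n, |1 - c η| ≤ G * α ^ n := fun n => by
      rw [← hcg n]
      have e1 : c (g n) - c η = ∫ x, ((g n).1 x - e x) ∂νP :=
        (integral_sub (LInfty.integrable hνi (g n)) (LInfty.integrable hνi η)).symm
      rw [e1, ← Real.norm_eq_abs]
      refine (norm_integral_le_of_norm_le ((LInfty.integrable hνi w).const_mul (G * α ^ n))
        (Filter.Eventually.of_forall fun x => ?_)).trans_eq ?_
      · rw [H.w_eq]; exact he_close n x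
      · rw [integral_const_mul]
        change G * α ^ n * c w = _
        rw [hcw, mul_one]
    have h2 : |1 - c η| ≤ 0 := by
      refine ge_of_tendsto' (x := Filter.atTop) (f := fun n => G * α ^ n) ?_ h1
      simpa using hαlim.const_mul G
    have := abs_nonpos_iff.1 h2
    linarith
  have hPη : P 1 η = θ₀ • η := by
    refine Subtype.ext (funext fun x => ?_)
    change (P 1 η).1 x = θ₀ * e x
    have h1 : ∀ n, |(P 1 (g n)).1 x - (P 1 η).1 x| ≤ G * α ^ n * (P 1 w).1 x := fun n => by
      have := H.abs_apply_le (f := g n - η) (b := G * α ^ n) (he_close n) 1 x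
      rwa [map_sub] at this
    have h2 : ∀ n, (P 1 (g n)).1 x = θ₀ * (g (n + 1)).1 x := fun n => by
      have : P 1 (g n) = (θ₀ ^ n)⁻¹ • P (1 + n) w := by rw [hg, map_smul, ← H.add]
      rw [this, hgx, add_comm 1 n, pow_succ]
      change (θ₀ ^ n)⁻¹ * _ = _
      field_simp
    have h3 : Filter.Tendsto (fun n => (P 1 (g n)).1 x) Filter.atTop (nhds (θ₀ * e x)) := by
      simp only [h2]
      exact ((Filter.tendsto_add_atTop_iff_nat 1).2 (he x)).const_mul θ₀
    refine tendsto_nhds_unique ?_ h3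
    rw [tendsto_iff_dist_tendsto_zero]
    refine squeeze_zero (fun _ => dist_nonneg) h1 ?_
    have := (hαlim.const_mul G).mul_const ((P 1 w).1 x)
    simpa using this
  refine ⟨νP, hνi, by rw [← hwψ]; exact hcw, θ₀, hθ₀pos, fun n f => ?_,
    ⟨C + A', by positivity, fun n => ⟨(hup n).trans ?_, (hlow n).trans ?_⟩⟩, η, he0, hPη, hcη,
    D * A' + D' * (C * A') + G, α, by positivity, hα0, hα1, fun n x => ?_, fun n f hf x => ?_⟩
  · change c (P n f) = θ₀ ^ n * c f
    rw [hcmul, hcpow, mul_comm]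
  · have := H.r_pos n; gcongr; linarith
  · gcongr; linarith
  · have := H.weight_pos x
    refine (he_close n x).trans ?_
    gcongr
    have : 0 < D * A' + D' * (C * A') := by positivity
    linarith
  · have hψx := H.weight_pos x
    have hrn := H.r_pos n
    change |(θ₀ ^ n)⁻¹ * (P n f).1 x - e x * c f| ≤ _
    have h1 : |(θ₀ ^ n)⁻¹ * ((P n f).1 x - ratio P w y₀ n f * (P n w).1 x)|
        ≤ D * A' * α ^ n * ψ x := by
      rw [abs_mul, abs_of_pos (by positivity), inv_mul_le_iff₀ (by positivity)]
      calc _ ≤ D * α ^ n * r n * ψ x := hrank n f hf x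
        _ ≤ D * α ^ n * (A' * θ₀ ^ n) * ψ x := by gcongr; exact hlow n
        _ = _ := by ring
    have h2 : |(c f - ratio P w y₀ n f) * (g n).1 x| ≤ D' * α ^ n * (C * A' * ψ x) := by
      rw [abs_mul, abs_of_nonneg (hg0 n x)]
      exact mul_le_mul (hclose n f hf) (hg_le n x) (hg0 n x) (by positivity)
    have hcf : |c f| ≤ 1 := by
      rw [← hcw, ← Real.norm_eq_abs]
      exact norm_integral_le_of_norm_le (LInfty.integrable hνi w)
        (Filter.Eventually.of_forall fun y => by rw [H.w_eq]; exact hf y)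
    have h3 : |c f * ((g n).1 x - e x)| ≤ G * α ^ n * ψ x := by
      rw [abs_mul]
      calc _ ≤ 1 * (G * α ^ n * ψ x) :=
            mul_le_mul hcf (he_close n x) (abs_nonneg _) zero_le_one
        _ = _ := one_mul _
    have e1 : (θ₀ ^ n)⁻¹ * (P n f).1 x - e x * c f
        = (θ₀ ^ n)⁻¹ * ((P n f).1 x - ratio P w y₀ n f * (P n w).1 x)
          - (c f - ratio P w y₀ n f) * (g n).1 x + c f * ((g n).1 x - e x) := by
      rw [hgx]; ring
    rw [e1]
    refine (abs_add_le _ _).trans ?_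
    have h4 := abs_sub ((θ₀ ^ n)⁻¹ * ((P n f).1 x - ratio P w y₀ n f * (P n w).1 x))
      ((c f - ratio P w y₀ n f) * (g n).1 x)
    calc _ ≤ D * A' * α ^ n * ψ x + D' * α ^ n * (C * A' * ψ x) + G * α ^ n * ψ x := by linarith
      _ = _ := by ring

end HarrisData

/-! ### Condition (G) provides the data for the contraction argument -/

theorem IsPositiveSemigroup.isPositiveOp {P : ℕ → LInfty ψ →ₗ[ℝ] LInfty ψ}
    (hP : IsPositiveSemigroup P) (n : ℕ) : IsPositiveOp (P n) := by
  obtain ⟨κ, hκ⟩ := hP.kernel n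
  intro f hf x
  rw [(hκ f x).2]
  exact integral_nonneg hf

theorem integrable_div_weight (hψ : Measurable ψ) (hpos : ∀ x, 0 < ψ x) (ν : Measure E)
    [IsProbabilityMeasure ν] (f : LInfty ψ) : Integrable (fun x => f.1 x / ψ x) ν := by
  obtain ⟨b, hb⟩ := f.2.2
  refine (integrable_const b).mono' (f.2.1.div hψ).aestronglyMeasurable
    (Filter.Eventually.of_forall fun x => ?_)
  rw [Real.norm_eq_abs, abs_div, abs_of_pos (hpos x), div_le_iff₀ (hpos x)]
  exact hb x

/-- The functional `f ↦ ∫ f / ψ ∂ν` on `L^∞(ψ)`, for a probability measure `ν`. -/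
noncomputable def weightedIntegral (hψ : Measurable ψ) (hpos : ∀ x, 0 < ψ x) (ν : Measure E)
    [IsProbabilityMeasure ν] : LInfty ψ →ₗ[ℝ] ℝ :=
  have hi := integrable_div_weight hψ hpos ν
  { toFun := fun f => ∫ x, f.1 x / ψ x ∂ν
    map_add' := fun f g => by
      rw [← integral_add (hi f) (hi g)]
      refine integral_congr_ae (Filter.Eventually.of_forall fun x => ?_)
      exact add_div _ _ _
    map_smul' := fun a f => by
      rw [RingHom.id_apply, smul_eq_mul, ← integral_const_mul]
      refine integral_congr_ae (Filter.Eventually.of_forall fun x => ?_)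
      exact mul_div_assoc _ _ _ }

/-- A minorization that is known on the functions `ψ 𝟙_A`, `A ⊆ K`, extends to all nonnegative
functions of `L^∞(ψ)`. -/
theorem minorization_of_indicator (hψ : Measurable ψ) (hpos : ∀ x, 0 < ψ x)
    {P : ℕ → LInfty ψ →ₗ[ℝ] LInfty ψ} (hP : IsPositiveSemigroup P) {K : Set E}
    (hK : MeasurableSet K) (ν : Measure E) [IsProbabilityMeasure ν] (hν : ν Kᶜ = 0) {n : ℕ}
    {c : ℝ} (hc : 0 ≤ c) {x : E}
    (h : ∀ (A : Set E) (hA : MeasurableSet A), A ⊆ K →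
      c * ν.real A * ψ x ≤ (P n (weightOn hψ hpos A hA)).1 x)
    (f : LInfty ψ) (hf : ∀ y, 0 ≤ f.1 y) :
    c * ψ x * weightedIntegral hψ hpos ν f ≤ (P n f).1 x := by
  obtain ⟨κ, hκ⟩ := hP.kernel n
  set lam := (κ x).withDensity fun y => ENNReal.ofReal (ψ y) with hlam
  have hcψ : 0 ≤ c * ψ x := mul_nonneg hc (hpos x).le
  have hle : ENNReal.ofReal (c * ψ x) • ν ≤ lam := by
    refine Measure.le_iff.2 fun A hA => ?_
    have hAK := hA.inter hK
    have h1 : ν A = ν (A ∩ K) := (measure_inter_conull hν).symm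
    have h2 : lam (A ∩ K) = ENNReal.ofReal ((P n (weightOn hψ hpos (A ∩ K) hAK)).1 x) := by
      rw [hlam, withDensity_apply _ hAK, (hκ _ x).2]
      have hint := (hκ (weightOn hψ hpos (A ∩ K) hAK) x).1
      change Integrable ((A ∩ K).indicator ψ) (κ x) at hint
      change _ = ENNReal.ofReal (∫ y, (A ∩ K).indicator ψ y ∂(κ x))
      rw [integral_indicator hAK, ofReal_integral_eq_lintegral_ofReal
        ((integrable_indicator_iff hAK).1 hint) (Filter.Eventually.of_forall fun y => (hpos y).le)]
    calc (ENNReal.ofReal (c * ψ x) • ν) A = ENNReal.ofReal (c * ψ x) * ν (A ∩ K) := by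
          rw [Measure.smul_apply, smul_eq_mul, h1]
      _ = ENNReal.ofReal (c * ψ x * ν.real (A ∩ K)) := by
          rw [ENNReal.ofReal_mul hcψ, ofReal_measureReal]
      _ ≤ lam (A ∩ K) := by
          rw [h2]
          refine ENNReal.ofReal_le_ofReal (le_trans (le_of_eq ?_) (h _ hAK Set.inter_subset_right))
          ring
      _ ≤ lam A := measure_mono Set.inter_subset_left
  have e1 : c * ψ x * weightedIntegral hψ hpos ν f
      = ∫ y, f.1 y / ψ y ∂(ENNReal.ofReal (c * ψ x) • ν) := by
    rw [integral_smul_measure, ENNReal.toReal_ofReal hcψ]; rfl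
  have e2 : (P n f).1 x = ∫ y, f.1 y / ψ y ∂lam := by
    rw [hlam, integral_withDensity_weight hψ hpos, (hκ f x).2]
    refine integral_congr_ae (Filter.Eventually.of_forall fun y => ?_)
    have := (hpos y).ne'
    simp only
    field_simp
  rw [e1, e2]
  refine integral_mono_measure hle (Filter.Eventually.of_forall fun y => ?_) ?_
  · exact div_nonneg (hf y) (hpos y).le
  · rw [hlam, integrable_withDensity_iff_integrable_smul' hψ.ennreal_ofReal
      (Filter.Eventually.of_forall fun y => ENNReal.ofReal_lt_top)]
    refine (hκ f x).1.congr (Filter.Eventually.of_forall fun y => ?_)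
    have := (hpos y).ne'
    simp only [ENNReal.toReal_ofReal (hpos y).le, smul_eq_mul]
    field_simp

/-- Aperiodicity turns a minorization on `K` at one time into minorizations on `K` at all large
times. -/
theorem eventually_minorization (hψ : Measurable ψ) (hpos : ∀ x, 0 < ψ x)
    {P : ℕ → LInfty ψ →ₗ[ℝ] LInfty ψ} (hP : IsPositiveSemigroup P) {K : Set E}
    (hK : MeasurableSet K) (ν : Measure E) [IsProbabilityMeasure ν] (hν : ν Kᶜ = 0) {n₁ : ℕ}
    {c : ℝ} (hc : 0 < c)
    (h : ∀ f : LInfty ψ, (∀ y, 0 ≤ f.1 y) → ∀ x ∈ K,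
      c * ψ x * weightedIntegral hψ hpos ν f ≤ (P n₁ f).1 x)
    (h₄ : ∀ x ∈ K, ∃ n₄ : ℕ, ∀ n ≥ n₄, 0 < (P n (weightOn hψ hpos K hK)).1 x) :
    ∃ N : ℕ, ∀ n ≥ N, ∃ d : ℝ, 0 < d ∧ ∀ f : LInfty ψ, (∀ x, 0 ≤ f.1 x) →
      ∀ x ∈ K, d * ψ x * weightedIntegral hψ hpos ν f ≤ (P n f).1 x := by
  set k := weightOn hψ hpos K hK with hk
  have hadd : ∀ m n f, P (m + n) f = P m (P n f) := fun m n f => by rw [hP.add]; rfl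
  have hpos' := hP.isPositiveOp
  have hk0 : ∀ x, 0 ≤ k.1 x := fun x => Set.indicator_nonneg (fun y _ => (hpos y).le) x
  have hk_on : ∀ x ∈ K, k.1 x = ψ x := fun x hx => Set.indicator_of_mem hx ψ
  have hk_off : ∀ x ∉ K, k.1 x = 0 := fun x hx => Set.indicator_of_notMem hx ψ
  have hle : ∀ (a : ℝ) (f : LInfty ψ), (∀ x, 0 ≤ f.1 x) → (∀ x ∈ K, a * ψ x ≤ f.1 x) →
      ∀ x, a * k.1 x ≤ f.1 x := fun a f hf h x => by
    by_cases hx : x ∈ K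
    · rw [hk_on x hx]; exact h x hx
    · rw [hk_off x hx, mul_zero]; exact hf x
  -- `ν` charges the set of points that are aperiodic from some common time on
  obtain ⟨N, hN⟩ : ∃ N : ℕ, ∀ n ≥ N, 0 < weightedIntegral hψ hpos ν (P n k) := by
    set S : ℕ → Set E := fun N => {x | ∀ n ≥ N, 0 < (P n k).1 x} with hS
    have hcover : K ⊆ ⋃ N, S N := fun x hx => by
      obtain ⟨n₄, hn₄⟩ := h₄ x hx
      exact Set.mem_iUnion.2 ⟨n₄, hn₄⟩
    have hne : ν (⋃ N, S N) ≠ 0 := fun h0 => by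
      have h1 : ν K = 0 := measure_mono_null hcover h0
      have h2 : ν Set.univ = 0 := by
        rw [← Set.union_compl_self K]
        exact measure_union_null h1 hν
      simp at h2
    obtain ⟨N, hN⟩ : ∃ N, ν (S N) ≠ 0 := by
      by_contra hcon
      push Not at hcon
      exact hne (measure_iUnion_null hcon)
    refine ⟨N, fun n hn => ?_⟩
    change 0 < ∫ x, (P n k).1 x / ψ x ∂ν
    rw [integral_pos_iff_support_of_nonneg
      (fun x => div_nonneg (hpos' n k hk0 x) (hpos x).le) (integrable_div_weight hψ hpos ν _)]
    refine lt_of_lt_of_le (pos_iff_ne_zero.2 hN) (measure_mono fun x hx => ?_)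
    exact (div_pos (hx n hn) (hpos x)).ne'
  refine ⟨n₁ + N + n₁, fun n hn => ?_⟩
  obtain ⟨s, rfl⟩ : ∃ s, n = n₁ + s + n₁ := ⟨n - n₁ - n₁, by omega⟩
  have hs := hN s (by omega)
  refine ⟨c * weightedIntegral hψ hpos ν (P s k) * c, by positivity, fun f hf x hx => ?_⟩
  set I := weightedIntegral hψ hpos ν f with hI
  have hI0 : 0 ≤ I := integral_nonneg fun y => div_nonneg (hf y) (hpos y).le
  have h1 : ∀ y, (c * I) * k.1 y ≤ (P n₁ f).1 y :=
    hle _ _ (hpos' n₁ f hf) fun y hy => by have := h f hf y hy; linarith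
  rw [hadd]
  calc c * weightedIntegral hψ hpos ν (P s k) * c * ψ x * I
      = (c * I) * (c * ψ x * weightedIntegral hψ hpos ν (P s k)) := by ring
    _ ≤ (c * I) * (P (n₁ + s) k).1 x := by
        rw [hadd]
        exact mul_le_mul_of_nonneg_left (h (P s k) (hpos' s k hk0) x hx) (by positivity)
    _ ≤ _ := (hpos' (n₁ + s)).smul_le h1 x

/-- Condition (G), in the form in which it is used: with the normalising sequence
`r n = P n ψ₂ (y₀) / ψ (y₀)` for some point `y₀` of `K`. -/
theorem ConditionG.exists_harrisData {hψ : Measurable ψ} {hpos : ∀ x, 0 < ψ x}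
    {P : ℕ → LInfty ψ →ₗ[ℝ] LInfty ψ} (hP : IsPositiveSemigroup P) {ψ₂ : LInfty ψ}
    (hG : ConditionG hψ hpos P ψ₂) :
    ∃ (k : LInfty ψ) (K : Set E) (ℓ : LInfty ψ →ₗ[ℝ] ℝ) (y₀ : E) (r : ℕ → ℝ)
      (θ₁ θ₂ c₂ C δ : ℝ), HarrisData P (weight hψ hpos) k K ℓ y₀ r θ₁ θ₂ c₂ C ∧ 0 < δ ∧
      (∀ x, ψ₂.1 x ≤ ψ x) ∧ (∀ x, δ * k.1 x ≤ ψ₂.1 x) ∧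
      ∀ x, θ₂ * ψ₂.1 x ≤ (P 1 ψ₂).1 x := by
  obtain ⟨θ₁, θ₂, c₁, c₂, c₃, n₁, K, hK, ν, hθ₁, hθ₂, hc₁, hc₂, hc₃, -, hψ₂, hνp, hνK, hG1, hθ,
    ⟨δ, hδ, hδK⟩, hle, hdrift, hgrow, hG3, hG4⟩ := hG
  set w := weight hψ hpos with hw
  set k := weightOn hψ hpos K hK with hk
  have hwx : ∀ x, w.1 x = ψ x := fun _ => rfl
  have hadd : ∀ m n f, P (m + n) f = P m (P n f) := fun m n f => by rw [hP.add]; rfl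
  have hzero : ∀ f, P 0 f = f := fun f => by rw [hP.zero]; rfl
  have hpos' := hP.isPositiveOp
  have hk_on : ∀ x ∈ K, k.1 x = ψ x := fun x hx => Set.indicator_of_mem hx ψ
  have hk_off : ∀ x ∉ K, k.1 x = 0 := fun x hx => Set.indicator_of_notMem hx ψ
  have hle' : ∀ x, ψ₂.1 x ≤ ψ x := fun x => (div_le_one (hpos x)).1 (hle x)
  have hδ' : ∀ x ∈ K, δ * ψ x ≤ ψ₂.1 x := fun x hx => (le_div_iff₀ (hpos x)).1 (hδK x hx)
  have hδk : ∀ x, δ * k.1 x ≤ ψ₂.1 x := fun x => by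
    by_cases hx : x ∈ K
    · rw [hk_on x hx]; exact hδ' x hx
    · rw [hk_off x hx, mul_zero]; exact hψ₂ x
  obtain ⟨y₀, hy₀⟩ : K.Nonempty := by
    by_contra h
    rw [Set.not_nonempty_iff_eq_empty] at h
    rw [h, Set.compl_empty, measure_univ] at hνK
    exact one_ne_zero hνK
  have hu0 : ∀ n x, 0 ≤ (P n w).1 x := fun n x => hpos' n w (fun y => (hpos y).le) x
  have hstep : ∀ n x, θ₂ * (P n ψ₂).1 x ≤ (P (n + 1) ψ₂).1 x := fun n x => by
    rw [hadd]; exact (hpos' n).smul_le hgrow x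
  have hiter : ∀ n x, θ₂ ^ n * ψ₂.1 x ≤ (P n ψ₂).1 x := fun n x => by
    induction n with
    | zero => simp [hzero]
    | succ n ih =>
      calc θ₂ ^ (n + 1) * ψ₂.1 x = θ₂ * (θ₂ ^ n * ψ₂.1 x) := by ring
        _ ≤ θ₂ * (P n ψ₂).1 x := by gcongr
        _ ≤ _ := hstep n x
  have h2le : ∀ n x, (P n ψ₂).1 x ≤ (P n w).1 x := fun n => (hpos' n).mono hle'
  -- comparison of the two Lyapunov functions along the semigroup
  set A := c₂ / δ / (θ₂ - θ₁) with hA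
  have hθ' := sub_pos.2 hθ
  have hA0 : 0 < A := by positivity
  have hcomp : ∀ n x, (P n w).1 x ≤ θ₁ ^ n * ψ x + A * (P n ψ₂).1 x := fun n x => by
    induction n with
    | zero =>
      have := mul_nonneg hA0.le (hψ₂ x)
      simp only [hzero, pow_zero, one_mul, hwx]
      linarith
    | succ n ih =>
      have h1 : (P (n + 1) w).1 x ≤ θ₁ * (P n w).1 x + (c₂ / δ) * (P n ψ₂).1 x := by
        rw [hadd]
        refine (hpos' n).le_add_smul (fun y => (hdrift y).trans ?_) x
        have := hδk y
        have e : c₂ * k.1 y ≤ c₂ / δ * ψ₂.1 y := by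
          rw [div_mul_eq_mul_div, le_div_iff₀ hδ, mul_assoc, mul_comm _ δ]
          exact mul_le_mul_of_nonneg_left this hc₂.le
        exact add_le_add le_rfl e
      have hAe : θ₁ * A + c₂ / δ = A * θ₂ := by rw [hA]; field_simp; ring
      calc _ ≤ θ₁ * (P n w).1 x + (c₂ / δ) * (P n ψ₂).1 x := h1
        _ ≤ θ₁ * (θ₁ ^ n * ψ x + A * (P n ψ₂).1 x) + (c₂ / δ) * (P n ψ₂).1 x := by gcongr
        _ = θ₁ ^ (n + 1) * ψ x + (θ₁ * A + c₂ / δ) * (P n ψ₂).1 x := by ring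
        _ = θ₁ ^ (n + 1) * ψ x + A * (θ₂ * (P n ψ₂).1 x) := by rw [hAe]; ring
        _ ≤ _ := by gcongr; exact hstep n x
  set r : ℕ → ℝ := fun n => (P n ψ₂).1 y₀ / ψ y₀ with hr
  have hψ0 := hpos y₀
  have hrlow : ∀ n, θ₂ ^ n * δ ≤ r n := fun n => by
    rw [hr, le_div_iff₀ hψ0, mul_assoc]
    exact (mul_le_mul_of_nonneg_left (hδ' y₀ hy₀) (by positivity)).trans (hiter n y₀)
  have hrpos : ∀ n, 0 < r n := fun n => lt_of_lt_of_le (by positivity) (hrlow n)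
  have hrgrow : ∀ n, θ₂ * r n ≤ r (n + 1) := fun n => by
    rw [hr, ← mul_div_assoc]
    exact div_le_div_of_nonneg_right (hstep n y₀) hψ0.le
  have hu_r : ∀ n, (P n w).1 y₀ / ψ y₀ ≤ (1 / δ + A) * r n := fun n => by
    have h1 := hcomp n y₀
    have h2 : θ₁ ^ n ≤ 1 / δ * r n := by
      rw [div_mul_eq_mul_div, one_mul, le_div_iff₀ hδ]
      exact (mul_le_mul_of_nonneg_right (pow_le_pow_left₀ hθ₁.le hθ.le n) hδ.le).trans (hrlow n)
    rw [div_le_iff₀ hψ0]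
    calc _ ≤ θ₁ ^ n * ψ y₀ + A * (P n ψ₂).1 y₀ := h1
      _ ≤ 1 / δ * r n * ψ y₀ + A * (r n * ψ y₀) := by
          have : r n * ψ y₀ = (P n ψ₂).1 y₀ := div_mul_cancel₀ _ hψ0.ne'
          rw [this]; gcongr
      _ = _ := by ring
  have hr_u : ∀ n, r n ≤ (P n w).1 y₀ / ψ y₀ := fun n =>
    div_le_div_of_nonneg_right (h2le n y₀) hψ0.le
  set C := max (max 1 c₃) (max (1 / δ) (c₃ * (1 / δ + A))) with hCdef
  have hC1 : 1 ≤ C := (le_max_left _ _).trans (le_max_left _ _)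
  have hC2 : c₃ ≤ C := (le_max_right _ _).trans (le_max_left _ _)
  have hC3 : 1 / δ ≤ C := (le_max_left _ _).trans (le_max_right _ _)
  have hC4 : c₃ * (1 / δ + A) ≤ C := (le_max_right _ _).trans (le_max_right _ _)
  have hC0 : 0 < C := one_pos.trans_le hC1
  have hupper : ∀ n x, (P n w).1 x ≤ C * r n * ψ x := fun n => by
    induction n with
    | zero =>
      intro x
      have hx := hpos x
      rw [hzero, hwx]
      have h1 : 1 ≤ C * r 0 := by
        have := hrlow 0
        rw [pow_zero, one_mul] at this
        calc 1 = 1 / δ * δ := by field_simp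
          _ ≤ C * r 0 := by gcongr
      nlinarith
    | succ n ih =>
      intro x
      have hx := hpos x
      have hrn := hrpos n
      have hrn1 := hrpos (n + 1)
      by_cases hxK : x ∈ K
      · -- on `K`, compare with `y₀` by the Harnack inequality
        have h1 := hG3 (n + 1) x hxK y₀ hy₀
        rw [← div_le_iff₀ hx]
        calc _ ≤ c₃ * ((P (n + 1) w).1 y₀ / ψ y₀) := h1
          _ ≤ c₃ * ((1 / δ + A) * r (n + 1)) := by gcongr; exact hu_r (n + 1)
          _ = c₃ * (1 / δ + A) * r (n + 1) := by ring
          _ ≤ _ := by gcongr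
      · -- off `K`, one step costs at most the factor `θ₁ ≤ θ₂`
        have h1 : (P (n + 1) w).1 x ≤ (C * r n) * (P 1 w).1 x := by
          rw [add_comm, hadd]
          exact (hpos' 1).le_smul ih x
        have h2 := hdrift x
        rw [Set.indicator_of_notMem hxK, mul_zero, add_zero] at h2
        calc _ ≤ C * r n * (P 1 w).1 x := h1
          _ ≤ C * r n * (θ₁ * ψ x) := by gcongr
          _ ≤ C * r n * (θ₂ * ψ x) := by gcongr
          _ = C * (θ₂ * r n) * ψ x := by ring
          _ ≤ _ := by gcongr; exact hrgrow n
  have hlower : ∀ n, ∀ x ∈ K, r n * ψ x ≤ C * (P n w).1 x := fun n x hx => by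
    have h1 := (hr_u n).trans (hG3 n y₀ hy₀ x hx)
    rw [← mul_div_assoc, le_div_iff₀ (hpos x)] at h1
    exact h1.trans (mul_le_mul_of_nonneg_right hC2 (hu0 n x))
  have hminor := eventually_minorization hψ hpos hP hK ν hνK hc₁
    (fun f hf x hx => minorization_of_indicator hψ hpos hP hK ν hνK hc₁.le (hG1 x hx) f hf) hG4
  refine ⟨k, K, weightedIntegral hψ hpos ν, y₀, r, θ₁, θ₂, c₂, C, δ,
    { weight_pos := hpos, zero := hzero, add := hadd, pos := hpos', w_eq := hwx, k_on := hk_on,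
      k_off := hk_off, θ₁_pos := hθ₁, θ_lt := hθ, c₂_pos := hc₂, one_le := hC1, drift := hdrift,
      r_pos := hrpos, r_grow := hrgrow, upper := hupper, lower := hlower, mem := hy₀,
      ℓ_mono := fun f g h => integral_mono (integrable_div_weight hψ hpos ν f)
        (integrable_div_weight hψ hpos ν g)
        (fun x => div_le_div_of_nonneg_right (h x) (hpos x).le),
      ℓ_lower := fun f a h => ?_, minor := hminor }, hδ, hle', hδk, hgrow⟩
  have h1 : ∫ _ : E, a ∂ν ≤ ∫ x, f.1 x / ψ x ∂ν := by
    refine integral_mono_ae (integrable_const a) (integrable_div_weight hψ hpos ν f) ?_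
    filter_upwards [measure_eq_zero_iff_ae_notMem.1 hνK] with x hx
    exact (le_div_iff₀ (hpos x)).2 (h x (not_not.1 hx))
  rw [integral_const, probReal_univ, one_smul] at h1
  exact h1

/-! ### From the uniform convergence to the ratio estimate -/

/-- The elementary optimisation behind the ratio estimate. Here `s` plays the role of
`μ(ψ₂) / μ(ψ₁)`, `e` that of `μ(η) / μ(ψ₁)` and `X` that of the error at time `n`. The quantity `e`
is in general only bounded below by a power of `s`, and the error bound `β ^ n / e` is traded
against the trivial bound `X ≤ 2`, at the price of a worse rate. -/
theorem exists_geometric_bound {q σ β C₁ C₂ : ℝ} (hq0 : 0 < q) (hq1 : q < 1) (hσ : 1 ≤ σ)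
    (hβ0 : 0 < β) (hβ1 : β < 1) (hC₁ : 0 < C₁) (hC₂ : 0 < C₂) :
    ∃ C α : ℝ, 0 < α ∧ α < 1 ∧ ∀ s e : ℝ, 0 < s → (∀ m : ℕ, s ≤ q ^ m + C₁ * σ ^ m * e) →
      ∀ (n : ℕ) (X : ℝ), X ≤ 2 → (0 < e → C₂ * β ^ n ≤ e / 2 → X ≤ 4 * C₂ * β ^ n / e) →
        X ≤ C * α ^ n / s := by
  set τ := √β with hτ
  have hτ0 : 0 < τ := Real.sqrt_pos.2 hβ0
  have hτ1 : τ < 1 := by rw [hτ, Real.sqrt_lt' one_pos]; simpa using hβ1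
  have hττ : τ * τ = β := Real.mul_self_sqrt hβ0.le
  have hσ0 : 0 < σ := one_pos.trans_le hσ
  -- block length `p`, long enough for `σ` to be absorbed by `√β ^ p`
  obtain ⟨p, hp0, hp⟩ : ∃ p : ℕ, 0 < p ∧ σ * τ ^ p ≤ 1 := by
    obtain ⟨p, hp⟩ := exists_pow_lt_of_lt_one (show 0 < 1 / σ by positivity) hτ1
    refine ⟨p + 1, Nat.succ_pos _, ?_⟩
    rw [← le_div_iff₀' hσ0]
    exact (pow_le_pow_of_le_one hτ0.le hτ1.le (Nat.le_succ p)).trans hp.le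
  obtain ⟨α, hα0, hα1, hα⟩ := exists_pow_div_le_geometric hq0 hq1 hp0
  refine ⟨4 / α ^ p + 8 * C₁ * C₂, max α τ, by positivity, max_lt hα1 hτ1,
    fun s e hs h n X hX2 hX => ?_⟩
  rw [le_div_iff₀ hs]
  have hατ : α ^ n ≤ (max α τ) ^ n := pow_le_pow_left₀ hα0.le (le_max_left _ _) n
  have hττn : τ ^ n ≤ (max α τ) ^ n := pow_le_pow_left₀ hτ0.le (le_max_right _ _) n
  have hmax : 0 < (max α τ) ^ n := by positivity
  rcases le_total (s / 2) (q ^ (n / p)) with h1 | h1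
  · have h2 := h1.trans (hα n)
    calc X * s ≤ 2 * s := by gcongr
      _ = 4 * (s / 2) := by ring
      _ ≤ 4 * (α ^ n / α ^ p) := by gcongr
      _ ≤ 4 * ((max α τ) ^ n / α ^ p) := by gcongr
      _ = 4 / α ^ p * (max α τ) ^ n := by ring
      _ ≤ _ := by
          refine mul_le_mul_of_nonneg_right ?_ hmax.le
          have : 0 < 8 * C₁ * C₂ := by positivity
          linarith
  · have h2 : s / 2 ≤ C₁ * σ ^ (n / p) * e := by linarith [h (n / p)]
    have he : 0 < e :=
      pos_of_mul_pos_right ((half_pos hs).trans_le h2) (by positivity)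
    have hXe : X * e ≤ 4 * C₂ * β ^ n := by
      rcases le_total (C₂ * β ^ n) (e / 2) with h3 | h3
      · exact (le_div_iff₀ he).1 (hX he h3)
      · calc X * e ≤ 2 * e := by gcongr
          _ ≤ _ := by linarith
    have h4 : σ ^ (n / p) * β ^ n ≤ τ ^ n := by
      have h5 : τ ^ n ≤ (τ ^ p) ^ (n / p) := by
        rw [← pow_mul]
        exact pow_le_pow_of_le_one hτ0.le hτ1.le (Nat.mul_div_le n p)
      calc σ ^ (n / p) * β ^ n = σ ^ (n / p) * τ ^ n * τ ^ n := by rw [← hττ, mul_pow]; ring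
        _ ≤ σ ^ (n / p) * (τ ^ p) ^ (n / p) * τ ^ n := by gcongr
        _ = (σ * τ ^ p) ^ (n / p) * τ ^ n := by rw [mul_pow]
        _ ≤ 1 * τ ^ n := by gcongr; exact pow_le_one₀ (by positivity) hp
        _ = τ ^ n := one_mul _
    rcases le_total X 0 with h0 | h0
    · exact (mul_nonpos_of_nonpos_of_nonneg h0 hs.le).trans (by positivity)
    calc X * s = 2 * (X * (s / 2)) := by ring
      _ ≤ 2 * (X * (C₁ * σ ^ (n / p) * e)) := by gcongr
      _ = 2 * C₁ * σ ^ (n / p) * (X * e) := by ring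
      _ ≤ 2 * C₁ * σ ^ (n / p) * (4 * C₂ * β ^ n) := by gcongr
      _ = 8 * C₁ * C₂ * (σ ^ (n / p) * β ^ n) := by ring
      _ ≤ 8 * C₁ * C₂ * (max α τ) ^ n := by gcongr; exact h4.trans hττn
      _ ≤ _ := by
          refine mul_le_mul_of_nonneg_right ?_ hmax.le
          have : 0 < 4 / α ^ p := by positivity
          linarith

/-- An integrated error bound from a pointwise one. -/
theorem abs_integral_sub_le {μ : Measure E} (hμ : Integrable ψ μ) (f η : LInfty ψ) {t c b : ℝ}
    (h : ∀ x, |t * f.1 x - η.1 x * c| ≤ b * ψ x) :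
    |t * ∫ x, f.1 x ∂μ - (∫ x, η.1 x ∂μ) * c| ≤ b * ∫ x, ψ x ∂μ := by
  rw [← integral_const_mul, ← integral_mul_const, ← integral_const_mul,
    ← integral_sub ((LInfty.integrable hμ f).const_mul t) ((LInfty.integrable hμ η).mul_const c),
    ← Real.norm_eq_abs]
  exact norm_integral_le_of_norm_le (hμ.const_mul b) (Filter.Eventually.of_forall h)

theorem wnorm_le (hpos : ∀ x, 0 < ψ x) {f : LInfty ψ} {b : ℝ} (hb : 0 ≤ b)
    (h : ∀ x, |f.1 x| ≤ b * ψ x) : wnorm f ≤ b :=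
  Real.iSup_le (fun x => (div_le_iff₀ (hpos x)).2 (h x)) hb

namespace HarrisData

variable {P : ℕ → LInfty ψ →ₗ[ℝ] LInfty ψ} {w k : LInfty ψ} {K : Set E}
    {ℓ : LInfty ψ →ₗ[ℝ] ℝ} {y₀ : E} {r : ℕ → ℝ} {θ₁ θ₂ c₂ C : ℝ}

theorem θ₂_le_of_r_le (H : HarrisData P w k K ℓ y₀ r θ₁ θ₂ c₂ C) {θ₀ A : ℝ} (hθ₀ : 0 < θ₀)
    (h : ∀ n, r n ≤ A * θ₀ ^ n) : θ₂ ≤ θ₀ := by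
  by_contra hlt
  push Not at hlt
  obtain ⟨n, hn⟩ := pow_unbounded_of_one_lt (A / r 0) ((one_lt_div hθ₀).2 hlt)
  have h1 := H.r_grow_iter 0 n
  rw [zero_add] at h1
  have h2 := h1.trans (h n)
  rw [div_pow, div_lt_div_iff₀ (H.r_pos 0) (by positivity)] at hn
  linarith

/-- Outside of `θ₁ ^ m ψ`, the function `P m ψ` is controlled by the eigenfunction `η`. -/
theorem weight_iter_le (H : HarrisData P w k K ℓ y₀ r θ₁ θ₂ c₂ C) {θ₀ B : ℝ} {η : LInfty ψ}
    (hη0 : ∀ x, 0 ≤ η.1 x) (hη : P 1 η = θ₀ • η) (hθ : θ₁ < θ₀)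
    (hB : 0 < B) (hk : ∀ x, k.1 x ≤ B * η.1 x) (m : ℕ) (x : E) :
    (P m w).1 x ≤ θ₁ ^ m * ψ x + c₂ * B / (θ₀ - θ₁) * θ₀ ^ m * η.1 x := by
  have hθ' := sub_pos.2 hθ
  have hc := H.c₂_pos
  have hθ₁ := H.θ₁_pos
  have hηm : ∀ n, P n η = θ₀ ^ n • η := fun n => by
    induction n with
    | zero => rw [H.zero, pow_zero, one_smul]
    | succ n ih => rw [H.add, hη, map_smul, ih, smul_smul, pow_succ']
  set G := c₂ * B / (θ₀ - θ₁) with hG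
  have hGe : θ₁ * G + c₂ * B = G * θ₀ := by rw [hG]; field_simp; ring
  have hG0 : 0 < G := by positivity
  induction m with
  | zero =>
    have := mul_nonneg hG0.le (hη0 x)
    simp only [H.zero, H.w_eq, pow_zero, one_mul, mul_one]
    linarith
  | succ m ih =>
    have h1 : (P m k).1 x ≤ B * (θ₀ ^ m * η.1 x) := by
      have := (H.pos m).le_smul hk x
      rwa [hηm] at this
    calc _ ≤ θ₁ * (P m w).1 x + c₂ * (P m k).1 x := H.drift_step m x
      _ ≤ θ₁ * (θ₁ ^ m * ψ x + G * θ₀ ^ m * η.1 x) + c₂ * (B * (θ₀ ^ m * η.1 x)) := by gcongr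
      _ = θ₁ ^ (m + 1) * ψ x + (θ₁ * G + c₂ * B) * θ₀ ^ m * η.1 x := by ring
      _ = _ := by rw [hGe]; ring

end HarrisData

end WeightedSemigroup

open WeightedSemigroup in
theorem theorem2p1 {E : Type*} [MeasurableSpace E] (ψ₁ : E → ℝ) (hψ : Measurable ψ₁)
    (hpos : ∀ x, 0 < ψ₁ x)
    (P : ℕ → WeightedSemigroup.LInfty ψ₁ →ₗ[ℝ] WeightedSemigroup.LInfty ψ₁)
    (hP : WeightedSemigroup.IsPositiveSemigroup P)
    (ψ₂ : WeightedSemigroup.LInfty ψ₁)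
    (hG : WeightedSemigroup.ConditionG hψ hpos P ψ₂) :
    ∃ νP : Measure E,
      Integrable ψ₁ νP ∧ ∫ x, ψ₁ x ∂νP = 1 ∧ 0 < ∫ x, ψ₂.1 x ∂νP ∧
      (∃ C α : ℝ, 0 < α ∧ α < 1 ∧
        ∀ f : WeightedSemigroup.LInfty ψ₁, (∀ x, |f.1 x| ≤ ψ₁ x) →
        ∀ μ : Measure E, Integrable ψ₁ μ → 0 < ∫ x, ψ₂.1 x ∂μ →
        ∀ n : ℕ,
          |(∫ x, (P n f).1 x ∂μ) / (∫ x, (P n (WeightedSemigroup.weight hψ hpos)).1 x ∂μ)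
              - ∫ x, f.1 x ∂νP|
            ≤ C * α ^ n * ((∫ x, ψ₁ x ∂μ) / ∫ x, ψ₂.1 x ∂μ)) ∧
      ∃ θ₀ : ℝ, 0 < θ₀ ∧
        (∀ (n : ℕ) (f : WeightedSemigroup.LInfty ψ₁),
          ∫ x, (P n f).1 x ∂νP = θ₀ ^ n * ∫ x, f.1 x ∂νP) ∧
        ∃ η : WeightedSemigroup.LInfty ψ₁,
          (∀ x, 0 ≤ η.1 x) ∧
          (∃ D γ : ℝ, 0 < γ ∧ γ < 1 ∧ ∀ n : ℕ,
            WeightedSemigroup.wnorm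
              ((θ₀ ^ n)⁻¹ • P n (WeightedSemigroup.weight hψ hpos) - η) ≤ D * γ ^ n) ∧
          P 1 η = θ₀ • η ∧
          ∫ x, η.1 x ∂νP = 1 ∧
          ∃ C' β : ℝ, 0 < C' ∧ 0 < β ∧ β < 1 ∧
            ∀ f : WeightedSemigroup.LInfty ψ₁, (∀ x, |f.1 x| ≤ ψ₁ x) →
            ∀ μ : Measure E, Integrable ψ₁ μ →
            ∀ n : ℕ,
              |(θ₀ ^ n)⁻¹ * (∫ x, (P n f).1 x ∂μ) - (∫ x, η.1 x ∂μ) * ∫ x, f.1 x ∂νP|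
                ≤ C' * β ^ n * ∫ x, ψ₁ x ∂μ := by
  obtain ⟨k, K, ℓ, y₀, r, θ₁, θ₂, c₂, C, δ, H, hδ, hle, hδk, hgrow⟩ :=
    hG.exists_harrisData hP
  choose κ hκ using hP.kernel
  set w := weight hψ hpos with hw
  obtain ⟨νP, hνi, hν1, θ₀, hθ₀, hinv, ⟨A, hA0, hA⟩, η, hη0, hPη, hνη, D, β, hD, hβ0, hβ1, hconv,
    hmain⟩ := H.exists_eigen hψ (fun n => κ n y₀) (fun n f => hκ n f y₀)
  have hC := H.C_pos
  have hc₂ := H.c₂_pos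
  have hθ₂ := H.θ₂_pos
  have hθ₂₀ : θ₂ ≤ θ₀ := H.θ₂_le_of_r_le hθ₀ fun n => (hA n).2
  have hθ₁₀ : θ₁ < θ₀ := H.θ_lt.trans_le hθ₂₀
  -- the eigenmeasure charges `ψ₂`: otherwise its eigenvalue would be at most `θ₁`
  have hνψ₂ : 0 < ∫ x, ψ₂.1 x ∂νP := by
    have h1 : ∫ x, (P 1 w).1 x ∂νP = θ₀ := by
      rw [hinv 1 w, pow_one]
      change θ₀ * ∫ x, ψ₁ x ∂νP = θ₀
      rw [hν1, mul_one]
    have h2 : ∫ x, (P 1 w).1 x ∂νP ≤ ∫ x, (θ₁ * ψ₁ x + c₂ / δ * ψ₂.1 x) ∂νP := by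
      refine integral_mono (LInfty.integrable hνi _)
        ((hνi.const_mul _).add ((LInfty.integrable hνi ψ₂).const_mul _)) fun x => ?_
      refine (H.drift x).trans (add_le_add le_rfl ?_)
      rw [div_mul_eq_mul_div, le_div_iff₀ hδ, mul_assoc, mul_comm _ δ]
      exact mul_le_mul_of_nonneg_left (hδk x) hc₂.le
    rw [integral_add (hνi.const_mul _) ((LInfty.integrable hνi ψ₂).const_mul _),
      integral_const_mul, integral_const_mul, hν1, h1, mul_one] at h2
    refine pos_of_mul_pos_right (a := c₂ / δ) ?_ (by positivity)
    linarith
  -- the eigenfunction dominates `ψ₁` on `K`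
  have hkη : ∀ x, k.1 x ≤ A * C * η.1 x := by
    intro x
    by_cases hx : x ∈ K
    · rw [H.k_on x hx]
      have hx0 := hpos x
      have h1 : ∀ n : ℕ, ψ₁ x ≤ A * C * (η.1 x + D * β ^ n * ψ₁ x) := fun n => by
        have h2 := (abs_le.1 (hconv n x)).2
        have hrn := H.r_pos n
        calc ψ₁ x = (θ₀ ^ n)⁻¹ * (θ₀ ^ n * ψ₁ x) := by field_simp
          _ ≤ (θ₀ ^ n)⁻¹ * (A * r n * ψ₁ x) := by gcongr; exact (hA n).1
          _ = A * ((θ₀ ^ n)⁻¹ * (r n * ψ₁ x)) := by ring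
          _ ≤ A * ((θ₀ ^ n)⁻¹ * (C * (P n w).1 x)) := by
              gcongr A * ((θ₀ ^ n)⁻¹ * ?_); exact H.lower n x hx
          _ = A * C * ((θ₀ ^ n)⁻¹ * (P n w).1 x) := by ring
          _ ≤ _ := by gcongr; linarith
      refine ge_of_tendsto' (x := Filter.atTop) ?_ h1
      have := ((((tendsto_pow_atTop_nhds_zero_of_lt_one hβ0.le hβ1).const_mul D).mul_const
        (ψ₁ x)).const_add (η.1 x)).const_mul (A * C)
      simpa using this
    · rw [H.k_off x hx]
      exact mul_nonneg (by positivity) (hη0 x)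
  have hiter : ∀ n x, θ₂ ^ n * ψ₂.1 x ≤ (P n w).1 x := fun n x => by
    refine le_trans ?_ ((H.pos n).mono hle x)
    induction n with
    | zero => simp [H.zero]
    | succ n ih =>
      calc θ₂ ^ (n + 1) * ψ₂.1 x = θ₂ * (θ₂ ^ n * ψ₂.1 x) := by ring
        _ ≤ θ₂ * (P n ψ₂).1 x := by gcongr
        _ ≤ _ := by rw [H.add]; exact (H.pos n).smul_le hgrow x
  set B := c₂ * (A * C) / (θ₀ - θ₁) with hB
  have hB0 : 0 < B := by have := sub_pos.2 hθ₁₀; positivity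
  have hψ₂η : ∀ m x, ψ₂.1 x ≤ (θ₁ / θ₂) ^ m * ψ₁ x + B * (θ₀ / θ₂) ^ m * η.1 x := fun m x => by
    have h1 := (hiter m x).trans
      (H.weight_iter_le hη0 hPη hθ₁₀ (by positivity) hkη m x)
    rw [← hB] at h1
    have hp : 0 < θ₂ ^ m := by positivity
    rw [← le_div_iff₀' hp] at h1
    refine h1.trans_eq ?_
    rw [div_pow, div_pow]
    field_simp
  have hint : ∀ f : LInfty ψ₁, (∀ x, |f.1 x| ≤ ψ₁ x) → ∀ μ : Measure E, Integrable ψ₁ μ →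
      ∀ n : ℕ, |(θ₀ ^ n)⁻¹ * (∫ x, (P n f).1 x ∂μ) - (∫ x, η.1 x ∂μ) * ∫ x, f.1 x ∂νP|
        ≤ D * β ^ n * ∫ x, ψ₁ x ∂μ := fun f hf μ hμ n =>
    abs_integral_sub_le hμ (P n f) η (hmain n f hf)
  refine ⟨νP, hνi, hν1, hνψ₂, ?_, θ₀, hθ₀, hinv, η, hη0, ⟨D, β, hβ0, hβ1, fun n => ?_⟩, hPη, hνη,
    D, β, hD, hβ0, hβ1, hint⟩
  · obtain ⟨G, α, hα0, hα1, hopt⟩ := exists_geometric_bound (q := θ₁ / θ₂) (σ := θ₀ / θ₂)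
      (β := β) (C₁ := B) (C₂ := D) (div_pos H.θ₁_pos hθ₂) ((div_lt_one hθ₂).2 H.θ_lt)
      ((one_le_div hθ₂).2 hθ₂₀) hβ0 hβ1 hB0 hD
    refine ⟨G, α, hα0, hα1, fun f hf μ hμ hμ₂ n => ?_⟩
    set I := ∫ x, ψ₁ x ∂μ with hI
    have hI0 : 0 < I :=
      hμ₂.trans_le (integral_mono (LInfty.integrable hμ ψ₂) hμ hle)
    set s := ∫ x, ψ₂.1 x ∂μ with hs
    set e := ∫ x, η.1 x ∂μ with he
    set F := ∫ x, (P n f).1 x ∂μ with hF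
    set M := ∫ x, (P n w).1 x ∂μ with hM
    set c := ∫ x, f.1 x ∂νP with hc
    have hM0 : 0 < M := by
      have h1 : θ₂ ^ n * s ≤ M := by
        rw [hs, ← integral_const_mul]
        exact integral_mono ((LInfty.integrable hμ ψ₂).const_mul _)
          (LInfty.integrable hμ (P n w)) (hiter n)
      exact lt_of_lt_of_le (by positivity) h1
    have hFM : |F| ≤ M := by
      rw [hF, ← Real.norm_eq_abs]
      refine norm_integral_le_of_norm_le (LInfty.integrable hμ (P n w))
        (Filter.Eventually.of_forall fun x => ?_)
      have := H.abs_apply_le (f := f) (b := 1) (fun y => by rw [one_mul]; exact hf y) n x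
      rwa [one_mul] at this
    have hc1 : |c| ≤ 1 := by
      rw [hc, ← Real.norm_eq_abs, ← hν1]
      exact norm_integral_le_of_norm_le hνi (Filter.Eventually.of_forall hf)
    have hs' : ∀ m : ℕ, s / I ≤ (θ₁ / θ₂) ^ m + B * (θ₀ / θ₂) ^ m * (e / I) := fun m => by
      have h1 : s ≤ (θ₁ / θ₂) ^ m * I + B * (θ₀ / θ₂) ^ m * e := by
        rw [hs, hI, he, ← integral_const_mul, ← integral_const_mul,
          ← integral_add (hμ.const_mul _) ((LInfty.integrable hμ η).const_mul _)]
        exact integral_mono (LInfty.integrable hμ ψ₂)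
          ((hμ.const_mul _).add ((LInfty.integrable hμ η).const_mul _)) (hψ₂η m)
      rw [div_le_iff₀ hI0]
      refine h1.trans_eq ?_
      field_simp
    have hX := hopt (s / I) (e / I) (by positivity) hs' n |F / M - c| ?_ ?_
    · refine hX.trans_eq ?_
      rw [div_div_eq_mul_div, mul_div_assoc]
    · have h1 : |F / M| ≤ 1 := by rwa [abs_div, abs_of_pos hM0, div_le_one hM0]
      exact (abs_sub _ _).trans (by linarith)
    · intro he0 hsmall
      have h1 := hint f hf μ hμ n
      have h2 := hint w (fun x => (abs_of_pos (hpos x)).le) μ hμ n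
      have hw1 : ∫ x, w.1 x ∂νP = 1 := hν1
      rw [hw1, mul_one] at h2
      change |(θ₀ ^ n)⁻¹ * M - e| ≤ D * β ^ n * I at h2
      change |(θ₀ ^ n)⁻¹ * F - e * c| ≤ D * β ^ n * I at h1
      set t := (θ₀ ^ n)⁻¹ with ht
      have ht0 : 0 < t := by positivity
      have hlow : e / 2 ≤ t * M := by
        have h3 := (abs_le.1 h2).1
        have h4 := mul_le_mul_of_nonneg_right hsmall hI0.le
        have h5 : e / I / 2 * I = e / 2 := by field_simp
        rw [h5] at h4
        linarith
      have hnum : |t * F - c * (t * M)| ≤ 2 * (D * β ^ n * I) := by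
        have h3 : t * F - c * (t * M) = (t * F - e * c) - c * (t * M - e) := by ring
        rw [h3]
        refine (abs_sub _ _).trans ?_
        rw [abs_mul]
        have h4 : |c| * |t * M - e| ≤ 1 * (D * β ^ n * I) :=
          mul_le_mul hc1 h2 (abs_nonneg _) zero_le_one
        linarith
      have he1 : 0 < e := by
        have := mul_pos he0 hI0
        rwa [div_mul_cancel₀ _ hI0.ne'] at this
      have htM : 0 < t * M := by positivity
      have h6 : F / M - c = (t * F - c * (t * M)) / (t * M) := by field_simp
      rw [h6, abs_div, abs_of_pos htM, div_le_div_iff₀ htM he0]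
      calc _ ≤ 2 * (D * β ^ n * I) * (e / I) := by gcongr
        _ = 4 * D * β ^ n * (e / 2) := by field_simp; ring
        _ ≤ _ := by gcongr
  · exact wnorm_le hpos (by positivity) (hconv n)
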